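/- Let $G=(V,E)$ be a finite simple connected graph with $n=|V|$ vertices and $|E|\ge n$ edges, and let $\gamma_2,\gamma\in[0,1]$. Consider the following randomised algorithm, designed to sample from the Gibbs distribution $\rho_{\gamma_2,\gamma}(S)\propto\gamma_2^{C_2(S)}\gamma^{C(S)}$ on the sets $S$ of arcs of $G$ in which every vertex is the tail of exactly one arc, where $C_2(S)$ is the number of directed $2$-cycles and $C(S)$ the number of directed cycles of length greater than $2$ in $(V,S)$. Start with $V_u=V$ and $S=\emptyset$. While $V_u\neq\emptyset$: choose an arbitrary vertex $v\in V_u$ (by any rule, which may depend on the history of the execution) and start a random walk at $v$, moving in each step to a uniformly random neighbour of the current vertex. Whenever the walk forms a cycle $C$, accept $C$ with probability $\gamma_2$ if it has length $2$ and with probability $\gamma$ if it is longer; otherwise erase $C$ from the walk and continue. The walk ends when it reaches a vertex of $V\setminus V_u$ or when a cycle is accepted; then remove all vertices of the walk from $V_u$ and add all arcs along the walk to $S$. When $V_u=\emptyset$, return $S$. The run-time is the number of elementary operations: initialising $V_u$ takes $n$ operations, and each evaluation of the loop condition (with the choice of a start vertex), each step of the walk (with a look-up of the status of the vertex reached), each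 decision whether to accept a cycle, each removal of a single vertex from the walk during an erasure, each recording of a single vertex and arc of a finished walk, and each check that an erasure or a recording is complete takes one. There is a universal constant $c$ such that, for all such $G$, all $\gamma_2\in[0,1]$ and $\gamma\in[1/2,1]$, and every rule for choosing the start vertices, the expected run-time of the algorithm is at most $c\,n^2$. -/

import Mathlib

open MeasureTheory ProbabilityTheory
open scoped ENNReal

namespace GibbsSampler

/-- The control state of the sampler.
* `choose`: the test of the outer loop, followed by the choice of a start vertex;
* `move`: the random walk makes one step;
* `test w`: the walk has just stepped to a vertex `w` that lies on the walk, so that a cycle through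
  `w` has been formed, and a coin decides whether the cycle is accepted;
* `erase w`: the cycle through `w` has been rejected and is being erased;
* `record w`: the walk is over; its vertices are being removed from `V_u` and its arcs added to `S`,
  and `w` is the head of the next arc to add;
* `halted`: the sampler has returned `S`. -/
inductive Phase (V : Type*) where
  | choose : Phase V
  | move : Phase V
  | test (w : V) : Phase V
  | erase (w : V) : Phase V
  | record (w : V) : Phase V
  | halted : Phase V

/-- The memory of the sampler: the set `V_u` of vertices that are not yet fixed, the set `S` of arcs
`(tail, head)` found so far, the current cycle-erased walk as a stack (its last vertex, which is the
current position, comes first; each entry carries an arc to the entry before it in the list), and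
the control state. -/
structure Config (V : Type*) where
  unfixed : Finset V
  arcs : Finset (V × V)
  walk : List V
  phase : Phase V

section Configurations

variable {V : Type*}

/-- Configurations are discrete data: every set of configurations is measurable. -/
instance : MeasurableSpace (Config V) := ⊤

instance : DiscreteMeasurableSpace (Config V) := ⟨fun _ => trivial⟩

theorem countable_phase [Countable V] : Countable (Phase V) := by
  let f : Phase V → ℕ × Option V := fun p => match p with
    | .choose => (0, none)
    | .move => (1, none)
    | .test w => (2, some w)
    | .erase w => (3, some w)
    | .record w => (4, some w)
    | .halted => (5, none)
  have hf : Function.Injective f := by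
    intro p q h
    cases p <;> cases q <;> simp_all [f]
  exact hf.countable

instance [Countable V] : Countable (Config V) := by
  have := countable_phase (V := V)
  let f : Config V → Finset V × Finset (V × V) × List V × Phase V :=
    fun c => (c.unfixed, c.arcs, c.walk, c.phase)
  have hf : Function.Injective f := by
    rintro ⟨a, b, c, d⟩ ⟨a', b', c', d'⟩ h
    simp_all [f]
  exact hf.countable

/-- The configuration `V_u = V`, `S = ∅` in which the outer loop is entered. -/
def initial (V : Type*) [Fintype V] : Config V where
  unfixed := Finset.univ
  arcs := ∅
  walk := []
  phase := .choose

end Configurations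

section Steps

variable {V : Type*} [Fintype V] [DecidableEq V]

/-- The walk that stands at the end of the stack `c.walk` steps to the vertex `w`. Either `w` is
already fixed, and the walk is over; or `w` lies on the walk, and a cycle is formed; or the walk is
extended by `w`. -/
def moveTo (c : Config V) (w : V) : Config V :=
  if w ∉ c.unfixed then { c with phase := .record w }
  else if w ∈ c.walk then { c with phase := .test w }
  else { c with walk := w :: c.walk }

/-- The length of the cycle formed when a walk with stack `l` steps to a vertex `w` of `l`. -/
def cycleLength (l : List V) (w : V) : ℕ := l.idxOf w + 1

/-- The law of the configuration that follows `c` in one elementary operation of the sampler on the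
graph `G`, where `v` is the start vertex to be used if a new walk has to be started. Each operation
makes at most one random draw and touches a bounded number of memory cells:
* outer loop: halt if `V_u = ∅`, otherwise start a walk at `v`;
* step to a uniformly random neighbour `w` of the current vertex, and look up the status of `w`;
* accept the cycle just formed with probability `γ₂` if it is a 2-cycle, `γ` if it is longer;
* erase a rejected cycle, one vertex at a time, back to the vertex `w` at which it was closed, from
  where the walk goes on;
* record a finished walk, one vertex and one arc at a time.
Unreachable configurations (a walk at an isolated vertex or with an empty stack) are left alone. -/
noncomputable def step (G : SimpleGraph V) [DecidableRel G.Adj] (γ₂ γ : unitInterval) (v : V)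
    (c : Config V) : Measure (Config V) :=
  match c.phase, c.walk with
  | .choose, _ =>
      if c.unfixed = ∅ then Measure.dirac { c with phase := .halted }
      else Measure.dirac { c with walk := [v], phase := .move }
  | .move, u :: _ =>
      if h : (G.neighborFinset u).Nonempty then
        ((PMF.uniformOfFinset (G.neighborFinset u) h).map (moveTo c)).toMeasure
      else Measure.dirac c
  | .test w, l =>
      bernoulliMeasure { c with phase := .record w } { c with phase := .erase w }
        (if cycleLength l w = 2 then γ₂ else γ)
  | .erase w, u :: l =>
      if u = w then Measure.dirac { c with phase := .move }
      else Measure.dirac { c with walk := l }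
  | .record w, u :: l =>
      Measure.dirac
        { unfixed := c.unfixed.erase u
          arcs := insert (u, w) c.arcs
          walk := l
          phase := .record u }
  | .record _, [] => Measure.dirac { c with phase := .choose }
  | _, _ => Measure.dirac c

instance (G : SimpleGraph V) [DecidableRel G.Adj] (γ₂ γ : unitInterval) (v : V) (c : Config V) :
    IsProbabilityMeasure (step G γ₂ γ v c) := by
  unfold step
  split <;> (try split_ifs) <;> infer_instance

/-- The configurations of an execution at the times `0, …, t`. -/
abbrev History (V : Type*) (t : ℕ) : Type _ := (i : Finset.Iic t) → Config V

/-- The configuration at time `t`. -/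
def History.last {t : ℕ} (h : History V t) : Config V := h ⟨t, Finset.mem_Iic.2 le_rfl⟩

/-- A rule for the line "let `v` be an arbitrary vertex in `V_u`": it may depend on everything that
has happened so far, and is only required to return an element of `V_u` when there is one. -/
structure Rule (V : Type*) where
  pick : (t : ℕ) → History V t → V
  pick_mem : ∀ (t : ℕ) (h : History V t), h.last.unfixed.Nonempty → pick t h ∈ h.last.unfixed

/-- The transition at time `t`: the law of the configuration at time `t + 1` given the past. -/
noncomputable def transition (G : SimpleGraph V) [DecidableRel G.Adj] (γ₂ γ : unitInterval)
    (r : Rule V) (t : ℕ) : Kernel (History V t) (Config V) :=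
  Kernel.ofFunOfCountable fun h => step G γ₂ γ (r.pick t h) h.last

instance (G : SimpleGraph V) [DecidableRel G.Adj] (γ₂ γ : unitInterval) (r : Rule V) (t : ℕ) :
    IsMarkovKernel (transition G γ₂ γ r t) :=
  ⟨fun h => inferInstanceAs (IsProbabilityMeasure (step G γ₂ γ (r.pick t h) h.last))⟩

/-- The law of the whole execution of the sampler, as an infinite sequence of configurations
(constant from the time at which the sampler halts, if it does). -/
noncomputable def execution (G : SimpleGraph V) [DecidableRel G.Adj] (γ₂ γ : unitInterval)
    (r : Rule V) : Measure (ℕ → Config V) :=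
  Kernel.traj (X := fun _ => Config V) (transition G γ₂ γ r) 0 (fun _ => initial V)

/-- The number of elementary operations in the execution `ω`: `|V|` operations to initialise
`V_u ← V`, and then the time at which the sampler halts (`∞` if it never does). -/
noncomputable def runTime (ω : ℕ → Config V) : ℝ≥0∞ :=
  Fintype.card V + ⨅ (t : ℕ) (_ : (ω t).phase = .halted), (t : ℝ≥0∞)

/-- The expected run-time of the sampler. -/
noncomputable def expectedRunTime (G : SimpleGraph V) [DecidableRel G.Adj] (γ₂ γ : unitInterval)
    (r : Rule V) : ℝ≥0∞ :=
  ∫⁻ ω, runTime ω ∂(execution G γ₂ γ r)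

end Steps

end GibbsSampler

set_option linter.unusedSectionVars false

/-! Let every vertex of a set $W$ choose a uniformly random neighbour, fix all other vertices, and
accept each cycle of the resulting map independently, a fixed point with probability 1. Let $Z(W)$
be the probability that no cycle is rejected (`goodMass`) and $B(W)$ the expected length of the
rejected cycle on the event that exactly one is (`badMass`). Up to constants, the cost of the
sampler is $n$ plus the total length of the erased cycles, and the latter has mean at most
$B(V)/Z(V)$.

This is shown by a potential argument. As for loop-erased random walk, the expected number of visits
of a walk in $U$ to a stack $l$ is at most the path probability times $Z(U\setminus l)/Z(U)$. Only
this supersolution property is proved (`occupation_balance`), and it is enough to bound the cost of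
a walk within any finite horizon (`goodMass_mul_cost_le`). Exploring a random map from the start
vertex until the path closes or leaves $U$ splits $Z(U)$ and $B(U)$ along the possible final stacks
(`tsum_stop_goodMass_le`, `tsum_stop_badMass_le`). Together these show that $1+5|U|+4B(U)/Z(U)$ pays
for one walk and all later ones, whichever start vertices are chosen (`walk_cost_le_potential`,
`cost_choose_le_potential`).

It remains to prove $B(V)\le 5n^2Z(V)$ (`badMass_univ_le`). A cycle of length at least 3 is rejected
no more often than accepted, as $\gamma\ge 1/2$; such cycles contribute at most $nZ(V)$. A rejected
2-cycle is removed by surgery (`exists_surgery`): a path running into it is reversed and its initial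
vertex is sent along an edge that the map does not use. This creates at most one cycle, of length at
least 3, which costs a factor 2, and the surgery can be undone once two vertices are known, which
costs a factor $n^2$. The edge exists because the graph is connected with at least $n$ edges. -/

namespace GibbsSampler

/-! ### Stacks, orbits and cycles of a self-map -/

section Maps

variable {V : Type*}

/-- The map `φ` sends every entry of the stack `l` to the entry before it, and the first entry
to `w`. -/
def Traces (φ : V → V) : V → List V → Prop
  | _, [] => True
  | w, u :: l => φ u = w ∧ Traces φ u l

/-- The probability that a walk with transition probabilities `P` runs through the stack `l`
and then steps to `w`. -/
noncomputable def pathProb (P : V → V → ℝ≥0∞) : V → List V → ℝ≥0∞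
  | _, [] => 1
  | w, u :: l => P u w * pathProb P u l

/-- The stack of the first `k` iterates of `φ` at `v`. -/
def orbitStack (φ : V → V) (v : V) : ℕ → List V
  | 0 => []
  | k + 1 => φ^[k] v :: orbitStack φ v k

theorem mem_orbitStack {φ : V → V} {v x : V} {k : ℕ} :
    x ∈ orbitStack φ v k ↔ ∃ i < k, φ^[i] v = x := by
  induction k with
  | zero => simp [orbitStack]
  | succ k ih =>
    simp only [orbitStack, List.mem_cons, ih, Nat.lt_succ_iff_lt_or_eq]
    constructor
    · rintro (rfl | ⟨i, hi, rfl⟩)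
      · exact ⟨k, Or.inr rfl, rfl⟩
      · exact ⟨i, Or.inl hi, rfl⟩
    · rintro ⟨i, hi | rfl, rfl⟩
      · exact Or.inr ⟨i, hi, rfl⟩
      · exact Or.inl rfl

/-- The last entry of the stack is the start of the walk, so a traced stack is determined by its
start and its length. All uniqueness statements about traced stacks reduce to comparing lengths. -/
theorem Traces.eq_orbitStack {φ : V → V} {v : V} {l : List V} {w : V} (h : Traces φ w l)
    (hl : l.getLast? = some v) : l = orbitStack φ v l.length ∧ w = φ^[l.length] v := by
  induction l generalizing w with
  | nil => simp at hl
  | cons u l ih =>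
    obtain ⟨h1, h2⟩ := h
    rcases l with _ | ⟨u', l⟩
    · simp at hl
      subst hl
      simp [orbitStack, h1]
    · obtain ⟨h3, h4⟩ := ih h2 (by simpa using hl)
      refine ⟨?_, ?_⟩
      · rw [List.length_cons, orbitStack, ← h3, ← h4]
      · rw [List.length_cons, Function.iterate_succ_apply', ← h4, h1]

theorem traces_orbitStack (φ : V → V) (v : V) (k : ℕ) : Traces φ (φ^[k] v) (orbitStack φ v k) := by
  induction k with
  | zero => trivial
  | succ k ih => exact ⟨(Function.iterate_succ_apply' φ k v).symm, ih⟩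

theorem Traces.congr {φ ψ : V → V} {l : List V} {w : V} (h : ∀ x ∈ l, φ x = ψ x) :
    Traces φ w l ↔ Traces ψ w l := by
  induction l generalizing w with
  | nil => rfl
  | cons u l ih =>
    simp only [Traces]
    rw [h u (by simp), ih (fun x hx => h x (by simp [hx]))]

theorem Traces.eqOn {φ ψ : V → V} {l : List V} {w : V} (h : Traces φ w l) (h' : Traces ψ w l) :
    ∀ x ∈ l, φ x = ψ x := by
  induction l generalizing w with
  | nil => simp
  | cons u l ih =>
    intro x hx
    rcases List.mem_cons.1 hx with rfl | hx
    · rw [h.1, h'.1]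
    · exact ih h.2 h'.2 x hx

theorem Traces.append {φ : V → V} {w u : V} {l l' : List V} :
    Traces φ w (l ++ u :: l') ↔ Traces φ w (l ++ [u]) ∧ Traces φ u l' := by
  induction l generalizing w with
  | nil => simp [Traces]
  | cons x l ih => simp [Traces, ih, and_assoc]

theorem pathProb_append (P : V → V → ℝ≥0∞) {w u : V} {l l' : List V} :
    pathProb P w (l ++ u :: l') = pathProb P w (l ++ [u]) * pathProb P u l' := by
  induction l generalizing w with
  | nil => simp [pathProb]
  | cons x l ih => simp [pathProb, ih, mul_assoc]

/-- `C` is the vertex set of a directed cycle of `φ`. -/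
def IsCycle [DecidableEq V] (φ : V → V) (C : Finset V) : Prop :=
  ∃ x n, 0 < n ∧ φ^[n] x = x ∧ C = (Finset.range n).image (fun i => φ^[i] x)

namespace IsCycle

variable [DecidableEq V] {φ ψ : V → V} {C D : Finset V}

theorem nonempty (h : IsCycle φ C) : C.Nonempty := by
  obtain ⟨x, n, hn, -, rfl⟩ := h
  exact ⟨x, Finset.mem_image.2 ⟨0, by simpa using hn, rfl⟩⟩

theorem map_mem (h : IsCycle φ C) {x : V} (hx : x ∈ C) : φ x ∈ C := by
  obtain ⟨y, n, hn, hy, rfl⟩ := h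
  obtain ⟨i, hi, rfl⟩ := Finset.mem_image.1 hx
  rw [Finset.mem_range] at hi
  rw [Finset.mem_image]
  by_cases h : i + 1 < n
  · exact ⟨i + 1, Finset.mem_range.2 h, Function.iterate_succ_apply' φ i y⟩
  · refine ⟨0, Finset.mem_range.2 hn, ?_⟩
    have : i + 1 = n := by omega
    change y = φ (φ^[i] y)
    rw [← Function.iterate_succ_apply' φ i y, Nat.succ_eq_add_one, this, hy]

theorem iterate_mem (h : IsCycle φ C) {x : V} (hx : x ∈ C) (k : ℕ) : φ^[k] x ∈ C := by
  induction k with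
  | zero => exact hx
  | succ k ih => rw [Function.iterate_succ_apply']; exact h.map_mem ih

theorem exists_iterate (h : IsCycle φ C) {x y : V} (hx : x ∈ C) (hy : y ∈ C) :
    ∃ k, φ^[k] x = y := by
  obtain ⟨z, n, hn, hz, rfl⟩ := h
  obtain ⟨i, hi, rfl⟩ := Finset.mem_image.1 hx
  obtain ⟨j, hj, rfl⟩ := Finset.mem_image.1 hy
  rw [Finset.mem_range] at hi hj
  refine ⟨(n - i) + j, ?_⟩
  rw [← Function.iterate_add_apply, show n - i + j + i = j + n by omega,
    Function.iterate_add_apply, hz]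

theorem mem_of_iterate_mem (h : IsCycle φ C) (h' : IsCycle φ D) {x : V} (hx : x ∈ C) {k : ℕ}
    (hk : φ^[k] x ∈ D) : x ∈ D := by
  obtain ⟨m, hm⟩ := h.exists_iterate (h.iterate_mem hx k) hx
  rw [← hm]
  exact h'.iterate_mem hk m

theorem eq_of_mem (h : IsCycle φ C) (h' : IsCycle φ D) {x : V} (hx : x ∈ C) (hx' : x ∈ D) :
    C = D := by
  ext y
  constructor
  · intro hy
    obtain ⟨k, rfl⟩ := h.exists_iterate hx hy
    exact h'.iterate_mem hx' k
  · intro hy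
    obtain ⟨k, rfl⟩ := h'.exists_iterate hx' hy
    exact h.iterate_mem hx k

theorem congr (h : IsCycle φ C) (hφ : ∀ x ∈ C, φ x = ψ x) : IsCycle ψ C := by
  obtain ⟨x, hx⟩ := id h.nonempty
  obtain ⟨y, n, hn, hy, hC⟩ := id h
  have hyC : y ∈ C := by
    rw [hC]; exact Finset.mem_image.2 ⟨0, by simpa using hn, rfl⟩
  have key : ∀ i, ψ^[i] y = φ^[i] y := by
    intro i
    induction i with
    | zero => rfl
    | succ i ih =>
      rw [Function.iterate_succ_apply', Function.iterate_succ_apply', ih,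
        hφ _ (h.iterate_mem hyC i)]
  exact ⟨y, n, hn, by rw [key, hy], by simp only [key, hC]⟩

theorem card_eq_one_of_fixed (h : IsCycle φ C) {x : V} (hx : x ∈ C) (hφ : φ x = x) :
    C.card = 1 := by
  rw [Finset.card_eq_one]
  refine ⟨x, Finset.eq_singleton_iff_unique_mem.2 ⟨hx, fun y hy => ?_⟩⟩
  obtain ⟨k, rfl⟩ := h.exists_iterate hx hy
  exact Function.iterate_fixed hφ k

end IsCycle

theorem isCycle_singleton [DecidableEq V] {φ : V → V} {x : V} (h : φ x = x) : IsCycle φ {x} :=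
  ⟨x, 1, one_pos, h, by simp⟩

theorem Traces.exists_iterate {φ : V → V} {w : V} {l : List V} (h : Traces φ w l) {x : V}
    (hx : x ∈ l) : ∃ k, φ^[k] x = w := by
  induction l generalizing w with
  | nil => simp at hx
  | cons u l ih =>
    rcases List.mem_cons.1 hx with rfl | hx
    · exact ⟨1, h.1⟩
    · obtain ⟨k, hk⟩ := ih h.2 hx
      exact ⟨k + 1, by rw [Function.iterate_succ_apply', hk, h.1]⟩

/-- If the stack `l`, with `w` on it, is traced by `φ` and closed at `w`, then `φ` has a cycle
through `w` of the length expected. -/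
theorem Traces.exists_isCycle [DecidableEq V] {φ : V → V} {w : V} {l : List V} (h : Traces φ w l)
    (hn : l.Nodup) (hw : w ∈ l) :
    ∃ C, IsCycle φ C ∧ w ∈ C ∧ C.card = cycleLength l w := by
  obtain ⟨l₁, l₂, rfl, hw₁⟩ := List.eq_append_cons_of_mem hw
  have hidx : cycleLength (l₁ ++ w :: l₂) w = (l₁ ++ [w]).length := by
    rw [cycleLength, List.idxOf_append_of_notMem hw₁]; simp
  rw [hidx]
  have h' := (Traces.append.1 h).1
  have hn' : (l₁ ++ [w]).Nodup := by
    have : List.Sublist (l₁ ++ [w]) (l₁ ++ w :: l₂) := by simp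
    exact hn.sublist this
  obtain ⟨e1, e2⟩ := h'.eq_orbitStack (v := w) (by simp)
  have hset : ((Finset.range (l₁ ++ [w]).length).image (fun i => φ^[i] w)) =
      (l₁ ++ [w]).toFinset := by
    ext x
    conv_rhs => rw [e1]
    simp [mem_orbitStack]
  refine ⟨_, ⟨w, (l₁ ++ [w]).length, by simp, e2.symm, rfl⟩, ?_, ?_⟩
  · rw [hset]; simp
  · rw [hset, List.toFinset_card_of_nodup hn']

/-- The map `φ`, with the entries of `l` turned into fixed points. -/
def reset [DecidableEq V] (φ : V → V) (l : List V) : V → V := fun z => if z ∈ l then z else φ z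

end Maps

/-! ### Acceptance weights of cycle families -/

section Weights

variable {V : Type*} [Fintype V] [DecidableEq V]

open Classical in
/-- The vertex sets of the directed cycles of `φ`. -/
noncomputable def cycles (φ : V → V) : Finset (Finset V) := Finset.univ.filter (IsCycle φ)

theorem mem_cycles {φ : V → V} {C : Finset V} : C ∈ cycles φ ↔ IsCycle φ C := by simp [cycles]

/-- The probability that all the cycles of a family are accepted, if a cycle of length `k` is
accepted with probability `a k`. -/
noncomputable def accepted (a : ℕ → ℝ≥0∞) (A : Finset (Finset V)) : ℝ≥0∞ := ∏ C ∈ A, a C.card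

/-- The expected length of the rejected cycle, on the event that exactly one cycle of the family
is rejected. -/
noncomputable def rejectedOne (a b : ℕ → ℝ≥0∞) (A : Finset (Finset V)) : ℝ≥0∞ :=
  ∑ C ∈ A, C.card * b C.card * accepted a (A.erase C)

/-- Fixed points serve as roots and as placeholders for explored vertices. The convention `a 1 = 1`,
`b 1 = 0` makes them invisible to the weights. -/
theorem accepted_eq_of_card_one {a : ℕ → ℝ≥0∞} (ha : a 1 = 1) {A F : Finset (Finset V)}
    (hFA : F ⊆ A) (h : ∀ C ∈ A, C ∉ F → C.card = 1) : accepted a A = accepted a F := by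
  refine (Finset.prod_subset hFA fun C hC hCF => ?_).symm
  rw [h C hC hCF, ha]

theorem rejectedOne_eq_of_card_one {a b : ℕ → ℝ≥0∞} (ha : a 1 = 1) (hb : b 1 = 0)
    {A F : Finset (Finset V)} (hFA : F ⊆ A) (h : ∀ C ∈ A, C ∉ F → C.card = 1) :
    rejectedOne a b A = rejectedOne a b F := by
  have h1 : rejectedOne a b A = ∑ C ∈ F, C.card * b C.card * accepted a (A.erase C) := by
    refine (Finset.sum_subset hFA fun C hC hCF => ?_).symm
    rw [h C hC hCF, hb]; simp
  rw [h1]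
  refine Finset.sum_congr rfl fun C hC => ?_
  rw [accepted_eq_of_card_one ha (Finset.erase_subset_erase C hFA)]
  intro D hD hDF
  rw [Finset.mem_erase] at hD hDF
  exact h D hD.2 fun hDF' => hDF ⟨hD.1, hDF'⟩

theorem accepted_insert {a : ℕ → ℝ≥0∞} {A : Finset (Finset V)} {C : Finset V} (hC : C ∉ A) :
    accepted a (insert C A) = a C.card * accepted a A := Finset.prod_insert hC

theorem rejectedOne_insert {a b : ℕ → ℝ≥0∞} {A : Finset (Finset V)} {C : Finset V} (hC : C ∉ A) :
    rejectedOne a b (insert C A) =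
      a C.card * rejectedOne a b A + C.card * b C.card * accepted a A := by
  rw [rejectedOne, Finset.sum_insert hC, Finset.erase_insert hC, add_comm]
  congr 1
  rw [rejectedOne, Finset.mul_sum]
  refine Finset.sum_congr rfl fun D hD => ?_
  have hne : D ≠ C := fun h => hC (h ▸ hD)
  rw [Finset.erase_insert_of_ne hne.symm, accepted_insert (by simp [hC])]
  ring

theorem cycles_filter_disjoint_congr {φ ψ : V → V} {s : Finset V} (h : ∀ x ∉ s, φ x = ψ x) :
    (cycles φ).filter (Disjoint s) = (cycles ψ).filter (Disjoint s) := by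
  ext C
  simp only [Finset.mem_filter, mem_cycles, and_congr_left_iff]
  intro hd
  have hC : ∀ x ∈ C, x ∉ s := fun x hx hxs => Finset.disjoint_left.1 hd hxs hx
  exact ⟨fun hc => hc.congr fun x hx => h x (hC x hx),
    fun hc => hc.congr fun x hx => (h x (hC x hx)).symm⟩

/-- A cycle of the reset map that meets `l` contains a fixed point and is therefore a singleton;
away from `l` nothing has changed. -/
theorem card_one_of_reset {φ : V → V} {l : List V} {C : Finset V} (hC : C ∈ cycles (reset φ l))
    (hC' : C ∉ (cycles φ).filter (Disjoint l.toFinset)) : C.card = 1 := by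
  rw [cycles_filter_disjoint_congr (ψ := reset φ l)
    (fun x hx => by simp [reset, List.mem_toFinset.not.1 hx])] at hC'
  simp only [Finset.mem_filter, hC, true_and, Finset.not_disjoint_iff] at hC'
  obtain ⟨x, hx, hxC⟩ := hC'
  exact (mem_cycles.1 hC).card_eq_one_of_fixed hxC (by simp [reset, List.mem_toFinset.1 hx])

theorem filter_subset_cycles_reset (φ : V → V) (l : List V) :
    (cycles φ).filter (Disjoint l.toFinset) ⊆ cycles (reset φ l) := by
  rw [cycles_filter_disjoint_congr (ψ := reset φ l)
    (fun x hx => by simp [reset, List.mem_toFinset.not.1 hx])]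
  exact Finset.filter_subset _ _

theorem accepted_reset {a : ℕ → ℝ≥0∞} (ha : a 1 = 1) (φ : V → V) (l : List V) :
    accepted a (cycles (reset φ l)) = accepted a ((cycles φ).filter (Disjoint l.toFinset)) :=
  accepted_eq_of_card_one ha (filter_subset_cycles_reset φ l) fun _ => card_one_of_reset

theorem rejectedOne_reset {a b : ℕ → ℝ≥0∞} (ha : a 1 = 1) (hb : b 1 = 0) (φ : V → V)
    (l : List V) : rejectedOne a b (cycles (reset φ l)) =
      rejectedOne a b ((cycles φ).filter (Disjoint l.toFinset)) :=
  rejectedOne_eq_of_card_one ha hb (filter_subset_cycles_reset φ l) fun _ => card_one_of_reset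

/-- Every vertex of the stack runs into the fixed point `w`, which is not on the stack, so none of
them lies on a cycle. -/
theorem Traces.cycles_eq_of_fixed {φ : V → V} {w : V} {l : List V} (h : Traces φ w l)
    (hw : w ∉ l) (hf : φ w = w) : (cycles φ).filter (Disjoint l.toFinset) = cycles φ := by
  rw [Finset.filter_true_of_mem]
  intro C hC
  rw [Finset.disjoint_left]
  intro x hx hxC
  have hC := mem_cycles.1 hC
  obtain ⟨k, hk⟩ := h.exists_iterate (List.mem_toFinset.1 hx)
  have := hC.mem_of_iterate_mem (isCycle_singleton hf) hxC (k := k) (by simp [hk])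
  rw [Finset.mem_singleton] at this
  exact hw (this ▸ List.mem_toFinset.1 hx)

/-- Every vertex of the stack runs into `w`, so a cycle that meets the stack must be the one through
`w`. -/
theorem Traces.exists_cycles_eq_insert {φ : V → V} {w : V} {l : List V} (h : Traces φ w l)
    (hn : l.Nodup) (hw : w ∈ l) : ∃ C, C.card = cycleLength l w ∧
      w ∈ C ∧ C ∉ (cycles φ).filter (Disjoint l.toFinset) ∧
      cycles φ = insert C ((cycles φ).filter (Disjoint l.toFinset)) := by
  obtain ⟨C, hC, hwC, hcard⟩ := h.exists_isCycle hn hw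
  have hnd : ¬ Disjoint l.toFinset C :=
    Finset.not_disjoint_iff.2 ⟨w, List.mem_toFinset.2 hw, hwC⟩
  refine ⟨C, hcard, hwC, by simp [hnd], ?_⟩
  ext D
  simp only [Finset.mem_insert, Finset.mem_filter, mem_cycles]
  constructor
  · intro hD
    by_cases hd : Disjoint l.toFinset D
    · exact Or.inr ⟨hD, hd⟩
    · obtain ⟨x, hx, hxD⟩ := Finset.not_disjoint_iff.1 hd
      obtain ⟨k, hk⟩ := h.exists_iterate (List.mem_toFinset.1 hx)
      exact Or.inl (hD.eq_of_mem hC hxD (hD.mem_of_iterate_mem hC hxD (k := k) (by rwa [hk])))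
  · rintro (rfl | hD)
    · exact hC
    · exact hD.1

end Weights

/-! ### Random maps and their exploration from a vertex -/

section Sums

variable {V : Type*} [Fintype V] [DecidableEq V]

open Classical in
/-- The sum of `F φ` over all maps `φ` that move only vertices of `W`, weighted with the
probability of `φ` when every vertex `v` of `W` chooses its image with the law `P v`. -/
noncomputable def mapSum (P : V → V → ℝ≥0∞) (W : Finset V) (F : (V → V) → ℝ≥0∞) : ℝ≥0∞ :=
  ∑ φ : V → V, if ∀ v ∉ W, φ v = v then (∏ v ∈ W, P v (φ v)) * F φ else 0

theorem mapSum_mono {P : V → V → ℝ≥0∞} {W : Finset V} {F F' : (V → V) → ℝ≥0∞}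
    (h : ∀ φ, (∀ v ∉ W, φ v = v) → F φ ≤ F' φ) : mapSum P W F ≤ mapSum P W F' := by
  refine Finset.sum_le_sum fun φ _ => ?_
  split_ifs with hφ
  · gcongr; exact h φ hφ
  · exact le_rfl

theorem mapSum_congr {P : V → V → ℝ≥0∞} {W : Finset V} {F F' : (V → V) → ℝ≥0∞}
    (h : ∀ φ, (∀ v ∉ W, φ v = v) → F φ = F' φ) : mapSum P W F = mapSum P W F' :=
  le_antisymm (mapSum_mono fun φ hφ => (h φ hφ).le) (mapSum_mono fun φ hφ => (h φ hφ).ge)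

theorem mapSum_add (P : V → V → ℝ≥0∞) (W : Finset V) (F F' : (V → V) → ℝ≥0∞) :
    mapSum P W (fun φ => F φ + F' φ) = mapSum P W F + mapSum P W F' := by
  rw [mapSum, mapSum, mapSum, ← Finset.sum_add_distrib]
  refine Finset.sum_congr rfl fun φ _ => ?_
  split_ifs <;> simp [mul_add]

theorem mapSum_const_mul (P : V → V → ℝ≥0∞) (W : Finset V) (c : ℝ≥0∞) (F : (V → V) → ℝ≥0∞) :
    mapSum P W (fun φ => c * F φ) = c * mapSum P W F := by
  rw [mapSum, mapSum, Finset.mul_sum]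
  refine Finset.sum_congr rfl fun φ _ => ?_
  split_ifs <;> ring

theorem mapSum_finset_sum {ι : Type*} (P : V → V → ℝ≥0∞) (W : Finset V) (s : Finset ι)
    (F : ι → (V → V) → ℝ≥0∞) :
    mapSum P W (fun φ => ∑ i ∈ s, F i φ) = ∑ i ∈ s, mapSum P W (F i) := by
  simp only [mapSum]
  rw [Finset.sum_comm]
  refine Finset.sum_congr rfl fun φ _ => ?_
  split_ifs <;> simp [Finset.mul_sum]

theorem mapSum_tsum {ι : Type*} (P : V → V → ℝ≥0∞) (W : Finset V) (F : ι → (V → V) → ℝ≥0∞) :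
    mapSum P W (fun φ => ∑' i, F i φ) = ∑' i, mapSum P W (F i) := by
  simp only [mapSum]
  rw [Summable.tsum_finsetSum fun _ _ => ENNReal.summable]
  refine Finset.sum_congr rfl fun φ _ => ?_
  split_ifs <;> simp [ENNReal.tsum_mul_left]

-- Independence of the choices: conditioning on `φ v = w` costs `P v w` and leaves a random map on
-- `W.erase v`. The bijection replaces the value `w` at `v` by `v` and back.
open Classical in
theorem mapSum_reset_vertex (P : V → V → ℝ≥0∞) {W : Finset V} {v : V} (hv : v ∈ W) (w : V)
    (F : (V → V) → ℝ≥0∞) :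
    mapSum P W (fun φ => if φ v = w then F (reset φ [v]) else 0) =
      P v w * mapSum P (W.erase v) F := by
  have h1 : mapSum P W (fun φ => if φ v = w then F (reset φ [v]) else 0) =
      ∑ φ ∈ Finset.univ.filter (fun φ : V → V => (∀ z ∉ W, φ z = z) ∧ φ v = w),
        (∏ z ∈ W, P z (φ z)) * F (reset φ [v]) := by
    rw [Finset.sum_filter, mapSum]
    refine Finset.sum_congr rfl fun φ _ => ?_
    by_cases h : ∀ z ∉ W, φ z = z <;> by_cases h' : φ v = w <;> simp [h, h']
  have h2 : mapSum P (W.erase v) F =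
      ∑ φ ∈ Finset.univ.filter (fun φ : V → V => ∀ z ∉ W.erase v, φ z = z),
        (∏ z ∈ W.erase v, P z (φ z)) * F φ := by
    rw [Finset.sum_filter, mapSum]
  rw [h1, h2, Finset.mul_sum]
  have hr : ∀ φ : V → V, reset φ [v] = Function.update φ v v := by
    intro φ; funext z
    by_cases hz : z = v
    · subst hz; simp [reset]
    · simp [reset, hz]
  refine Finset.sum_bij' (fun φ _ => Function.update φ v v) (fun ψ _ => Function.update ψ v w)
    ?_ ?_ ?_ ?_ ?_
  · intro φ hφ
    simp only [Finset.mem_filter, Finset.mem_univ, true_and, Finset.mem_erase] at hφ ⊢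
    intro z hz
    by_cases hzv : z = v
    · subst hzv; simp
    · rw [Function.update_of_ne hzv]; exact hφ.1 z fun h => hz ⟨hzv, h⟩
  · intro φ hφ
    simp only [Finset.mem_filter, Finset.mem_univ, true_and, Finset.mem_erase] at hφ ⊢
    refine ⟨fun z hz => ?_, by simp⟩
    have hzv : z ≠ v := fun h => hz (h ▸ hv)
    rw [Function.update_of_ne hzv]; exact hφ z fun h => hz h.2
  · intro φ hφ
    simp only [Finset.mem_filter, Finset.mem_univ, true_and] at hφ
    simp [← hφ.2]
  · intro φ hφ
    simp only [Finset.mem_filter, Finset.mem_univ, true_and] at hφ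
    have := hφ v (by simp)
    simp only [Function.update_idem]
    rw [Function.update_eq_self_iff, this]
  · intro φ hφ
    simp only [Finset.mem_filter, Finset.mem_univ, true_and] at hφ
    rw [← Finset.mul_prod_erase W _ hv, hφ.2, hr, mul_assoc]
    congr 2
    refine Finset.prod_congr rfl fun z hz => ?_
    rw [Function.update_of_ne (Finset.ne_of_mem_erase hz)]

open Classical in
theorem mapSum_reset (P : V → V → ℝ≥0∞) {W : Finset V} {l : List V} (hn : l.Nodup)
    (hl : ∀ x ∈ l, x ∈ W) (w : V) (F : (V → V) → ℝ≥0∞) :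
    mapSum P W (fun φ => if Traces φ w l then F (reset φ l) else 0) =
      pathProb P w l * mapSum P (W \ l.toFinset) F := by
  induction l generalizing w W F with
  | nil =>
    have h : ∀ φ : V → V, reset φ [] = φ := fun φ => by funext z; simp [reset]
    simp [Traces, pathProb, h]
  | cons u l ih =>
    have hu : u ∉ l := (List.nodup_cons.1 hn).1
    have h1 := mapSum_reset_vertex P (hl u (by simp)) w
      (fun ψ => if Traces ψ u l then F (reset ψ l) else 0)
    rw [ih (List.nodup_cons.1 hn).2 (fun x hx => Finset.mem_erase.2
      ⟨fun h : x = u => hu (h ▸ hx), hl x (by simp [hx])⟩)] at h1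
    rw [pathProb, mul_assoc]
    have h2 : W \ (u :: l).toFinset = W.erase u \ l.toFinset := by
      ext z; simp only [List.toFinset_cons, Finset.mem_sdiff, Finset.mem_insert,
        Finset.mem_erase]; tauto
    rw [h2, ← h1]
    refine mapSum_congr fun φ _ => ?_
    have h3 : Traces (reset φ [u]) u l ↔ Traces φ u l := by
      refine Traces.congr fun x hx => ?_
      have : x ≠ u := fun h => hu (h ▸ hx)
      simp [reset, this]
    have h4 : reset (reset φ [u]) l = reset φ (u :: l) := by
      funext z
      by_cases hz : z = u <;> by_cases hz' : z ∈ l <;> simp [reset, hz, hz']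
    simp only [Traces, h3, h4]
    by_cases h5 : φ u = w <;> by_cases h6 : Traces φ u l <;> simp [h5, h6]

/-- The stack `l` is that of a cycle-free walk in `W` started at `v`. -/
def IsStack (W : Finset V) (v : V) (l : List V) : Prop :=
  l.Nodup ∧ (∀ x ∈ l, x ∈ W) ∧ l.getLast? = some v

theorem tsum_ite_le_of_unique {ι : Type*} (p : ι → Prop) [DecidablePred p]
    (h : ∀ i j, p i → p j → i = j) (c : ℝ≥0∞) : ∑' i, (if p i then c else 0) ≤ c := by
  by_cases hp : ∃ i, p i
  · obtain ⟨i, hi⟩ := hp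
    rw [tsum_eq_single i fun j hj => if_neg fun hj' => hj (h j i hj' hi)]
    simp [hi]
  · rw [not_exists] at hp
    simp [hp]

/-- A map traces at most one walk from `v` up to the moment when it leaves `W` or closes a
cycle. -/
theorem Traces.unique {φ : V → V} {W : Finset V} {v w w' : V} {l l' : List V}
    (hl : IsStack W v l) (hw : w ∈ l ∨ w ∉ W) (h : Traces φ w l)
    (hl' : IsStack W v l') (hw' : w' ∈ l' ∨ w' ∉ W) (h' : Traces φ w' l') : l = l' ∧ w = w' := by
  -- A longer stack along the same orbit would contain the vertex `w` at which the shorter one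
  -- stopped: either a repetition, or a vertex outside `W`.
  have nlt : ∀ {l l' : List V} {w : V}, IsStack W v l → (w ∈ l ∨ w ∉ W) → Traces φ w l →
      IsStack W v l' → l' = orbitStack φ v l'.length → ¬ l.length < l'.length := by
    intro l l' w hl hw h hl' e' hlt
    obtain ⟨e, ew⟩ := h.eq_orbitStack hl.2.2
    have hmem : w ∈ l' := by
      rw [e', mem_orbitStack]; exact ⟨l.length, hlt, ew.symm⟩
    rcases hw with hw | hw
    · rw [e, mem_orbitStack] at hw
      obtain ⟨i, hi, hiw⟩ := hw
      have key : ∀ k, l.length < k → ¬ (orbitStack φ v k).Nodup := by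
        intro k hk
        induction k, hk using Nat.le_induction with
        | base =>
          intro hnd
          simp only [orbitStack, List.nodup_cons, mem_orbitStack] at hnd
          exact hnd.1 ⟨i, hi, by rw [hiw, ew]⟩
        | succ k hk ih =>
          intro hnd
          simp only [orbitStack, List.nodup_cons] at hnd
          exact ih hnd.2
      exact key _ hlt (e' ▸ hl'.1)
    · exact hw (hl'.2.1 w hmem)
  obtain ⟨e, ew⟩ := h.eq_orbitStack hl.2.2
  obtain ⟨e', ew'⟩ := h'.eq_orbitStack hl'.2.2
  have hlen : l.length = l'.length :=
    le_antisymm (not_lt.1 (nlt hl' hw' h' hl e)) (not_lt.1 (nlt hl hw h hl' e'))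
  exact ⟨by rw [e, e', hlen], by rw [ew, ew', hlen]⟩

open Classical in
/-- Exploring a map from `v` until `W` is left or a cycle is closed. -/
theorem tsum_explore_le (P : V → V → ℝ≥0∞) (W : Finset V) (v : V) (F : (V → V) → ℝ≥0∞) :
    ∑' q : List V × V, (if IsStack W v q.1 ∧ (q.2 ∈ q.1 ∨ q.2 ∉ W) then
      mapSum P W (fun φ => if Traces φ q.2 q.1 then F φ else 0) else 0) ≤ mapSum P W F := by
  calc _ = ∑' q : List V × V, mapSum P W (fun φ =>
        if (IsStack W v q.1 ∧ (q.2 ∈ q.1 ∨ q.2 ∉ W)) ∧ Traces φ q.2 q.1 then F φ else 0) := by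
        refine tsum_congr fun q => ?_
        by_cases h : IsStack W v q.1 ∧ (q.2 ∈ q.1 ∨ q.2 ∉ W)
        · simp only [h, true_and, if_true]
        · simp [h, mapSum]
    _ = mapSum P W (fun φ => ∑' q : List V × V,
        if (IsStack W v q.1 ∧ (q.2 ∈ q.1 ∨ q.2 ∉ W)) ∧ Traces φ q.2 q.1 then F φ else 0) :=
        (mapSum_tsum P W _).symm
    _ ≤ mapSum P W F := by
        refine mapSum_mono fun φ _ => tsum_ite_le_of_unique _ (fun q q' h h' => ?_) _
        obtain ⟨h1, h2⟩ := Traces.unique h.1.1 h.1.2 h.2 h'.1.1 h'.1.2 h'.2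
        exact Prod.ext h1 h2

end Sums

/-! ### Decomposition of the two masses along the explored path -/

section Identities

variable {V : Type*} [Fintype V] [DecidableEq V]

/-- The probability that a random map on `W` has only accepted cycles. -/
noncomputable def goodMass (P : V → V → ℝ≥0∞) (a : ℕ → ℝ≥0∞) (W : Finset V) : ℝ≥0∞ :=
  mapSum P W fun φ => accepted a (cycles φ)

/-- The expected length of the rejected cycle of a random map on `W`, on the event that exactly
one of its cycles is rejected. -/
noncomputable def badMass (P : V → V → ℝ≥0∞) (a b : ℕ → ℝ≥0∞) (W : Finset V) : ℝ≥0∞ :=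
  mapSum P W fun φ => rejectedOne a b (cycles φ)

/-- The probability that a walk with stack `l` ends when it steps to the vertex `w`, which lies on
the walk or outside the set of unfixed vertices. -/
noncomputable def stopProb (a : ℕ → ℝ≥0∞) (l : List V) (w : V) : ℝ≥0∞ :=
  if w ∈ l then a (cycleLength l w) else 1

/-- The expected length of the rejected cycle when a walk with stack `l` steps to `w`. -/
noncomputable def rejectedLength (b : ℕ → ℝ≥0∞) (l : List V) (w : V) : ℝ≥0∞ :=
  if w ∈ l then cycleLength l w * b (cycleLength l w) else 0

variable {P : V → V → ℝ≥0∞} {a b : ℕ → ℝ≥0∞}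

/-- The explored path contributes one cycle if it closes on itself and none if it leaves `W`; what
is unexplored is an independent random map on `W \ l.toFinset`. -/
theorem mapSum_traces_accepted (ha : a 1 = 1) {W : Finset V} {v w : V} {l : List V}
    (hl : IsStack W v l) (hw : w ∈ l ∨ w ∉ W) [∀ φ : V → V, Decidable (Traces φ w l)] :
    mapSum P W (fun φ => if Traces φ w l then accepted a (cycles φ) else 0) =
      pathProb P w l * (stopProb a l w * goodMass P a (W \ l.toFinset)) := by
  rw [goodMass, ← mapSum_const_mul, ← mapSum_reset P hl.1 hl.2.1]
  refine mapSum_congr fun φ hφ => ?_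
  by_cases h : Traces φ w l
  · simp only [h, if_true, accepted_reset ha, stopProb]
    split_ifs with hwl
    · obtain ⟨C, hC, -, hC', e⟩ := h.exists_cycles_eq_insert hl.1 hwl
      conv_lhs => rw [e]
      rw [accepted_insert hC', hC]
    · rw [h.cycles_eq_of_fixed hwl (hφ w (hw.resolve_left hwl)), one_mul]
  · simp [h]

/-- The single rejected cycle is either in the unexplored part, and then the explored path must be
harmless, or it is the cycle just closed, and then the rest must be harmless. -/
theorem mapSum_traces_rejectedOne (ha : a 1 = 1) (hb : b 1 = 0) {W : Finset V} {v w : V}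
    {l : List V} (hl : IsStack W v l) (hw : w ∈ l ∨ w ∉ W)
    [∀ φ : V → V, Decidable (Traces φ w l)] :
    mapSum P W (fun φ => if Traces φ w l then rejectedOne a b (cycles φ) else 0) =
      pathProb P w l * (stopProb a l w * badMass P a b (W \ l.toFinset) +
        rejectedLength b l w * goodMass P a (W \ l.toFinset)) := by
  rw [goodMass, badMass, ← mapSum_const_mul, ← mapSum_const_mul, ← mapSum_add,
    ← mapSum_reset P hl.1 hl.2.1]
  refine mapSum_congr fun φ hφ => ?_
  by_cases h : Traces φ w l
  · simp only [h, if_true, accepted_reset ha, rejectedOne_reset ha hb, stopProb, rejectedLength]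
    split_ifs with hwl
    · obtain ⟨C, hC, -, hC', e⟩ := h.exists_cycles_eq_insert hl.1 hwl
      conv_lhs => rw [e]
      rw [rejectedOne_insert hC', hC]
    · rw [h.cycles_eq_of_fixed hwl (hφ w (hw.resolve_left hwl)), one_mul, zero_mul, add_zero]
  · simp [h]

open Classical in
theorem tsum_stop_goodMass_le (ha : a 1 = 1) (W : Finset V) (v : V) :
    ∑' q : List V × V, (if IsStack W v q.1 ∧ (q.2 ∈ q.1 ∨ q.2 ∉ W) then
      pathProb P q.2 q.1 * (stopProb a q.1 q.2 * goodMass P a (W \ q.1.toFinset)) else 0) ≤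
      goodMass P a W := by
  refine le_trans (le_of_eq (tsum_congr fun q => ?_))
    (tsum_explore_le P W v fun φ => accepted a (cycles φ))
  split_ifs with h
  · rw [mapSum_traces_accepted ha h.1 h.2]
  · rfl

open Classical in
theorem tsum_stop_badMass_le (ha : a 1 = 1) (hb : b 1 = 0) (W : Finset V) (v : V) :
    ∑' q : List V × V, (if IsStack W v q.1 ∧ (q.2 ∈ q.1 ∨ q.2 ∉ W) then
      pathProb P q.2 q.1 * (stopProb a q.1 q.2 * badMass P a b (W \ q.1.toFinset) +
        rejectedLength b q.1 q.2 * goodMass P a (W \ q.1.toFinset)) else 0) ≤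
      badMass P a b W := by
  refine le_trans (le_of_eq (tsum_congr fun q => ?_))
    (tsum_explore_le P W v fun φ => rejectedOne a b (cycles φ))
  split_ifs with h
  · rw [mapSum_traces_rejectedOne ha hb h.1 h.2]
  · rfl

theorem accepted_anti (ha : ∀ k, a k ≤ 1) {A F : Finset (Finset V)} (h : F ⊆ A) :
    accepted a A ≤ accepted a F :=
  Finset.prod_le_prod_of_subset_of_le_one' h fun _ _ _ => ha _

theorem cycleLength_of_getLast? {l : List V} {v : V} (hn : l.Nodup) (hl : l.getLast? = some v) :
    cycleLength l v = l.length := by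
  obtain ⟨l', rfl⟩ := List.getLast?_eq_some_iff.1 hl
  have hv : v ∉ l' := fun h => by
    rw [List.nodup_append] at hn
    exact hn.2.2 v h v (by simp) rfl
  rw [cycleLength, List.idxOf_append_of_notMem hv]
  simp

-- If `v` lies on a cycle of length `k`, pinning `v` or the whole cycle leaves the same other
-- nontrivial cycles, and `a k + b k = 1` gives equality. Otherwise the sum is empty and pinning can
-- only remove factors that are at most 1.
open Classical in
theorem accepted_add_tsum_le (ha : a 1 = 1) (hab : ∀ k, a k + b k = 1) (W : Finset V) (v : V)
    (φ : V → V) :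
    accepted a (cycles φ) + ∑' l : List V, (if IsStack W v l ∧ Traces φ v l then
      b l.length * accepted a (cycles (reset φ l)) else 0) ≤
      accepted a (cycles (reset φ [v])) := by
  have ha1 : ∀ k, a k ≤ 1 := fun k => hab k ▸ le_self_add
  rw [accepted_reset ha φ [v]]
  by_cases h : ∃ l, IsStack W v l ∧ Traces φ v l
  · obtain ⟨l, hl, ht⟩ := h
    have hv : v ∈ l := List.mem_of_getLast? hl.2.2
    rw [tsum_eq_single l]
    · obtain ⟨C, hC, hvC, hC', e⟩ := ht.exists_cycles_eq_insert hl.1 hv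
      rw [cycleLength_of_getLast? hl.1 hl.2.2] at hC
      have hF : (cycles φ).filter (Disjoint [v].toFinset) =
          (cycles φ).filter (Disjoint l.toFinset) := by
        ext D
        simp only [Finset.mem_filter, and_congr_right_iff]
        intro hD
        rw [e] at hD
        constructor
        · intro hd
          rcases Finset.mem_insert.1 hD with rfl | hD
          · simp [hvC] at hd
          · exact (Finset.mem_filter.1 hD).2
        · intro hd
          exact Finset.disjoint_of_subset_left (by simpa using hv) hd
      rw [if_pos ⟨hl, ht⟩, accepted_reset ha, hF]
      conv_lhs => enter [1]; rw [e]
      rw [accepted_insert hC', hC, ← add_mul, hab, one_mul]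
    · intro l' hl'
      refine if_neg fun h => hl' ?_
      exact (Traces.unique h.1 (Or.inl (List.mem_of_getLast? h.1.2.2)) h.2 hl (Or.inl hv) ht).1
  · have : ∀ l, ¬ (IsStack W v l ∧ Traces φ v l) := fun l hl => h ⟨l, hl⟩
    simp only [this, if_false, tsum_zero, add_zero]
    exact accepted_anti ha1 (Finset.filter_subset _ _)

open Classical in
/-- Pinning a vertex `v` of `W` makes all the cycles through `v` harmless. -/
theorem goodMass_add_tsum_le (hP : ∀ v, ∑ w, P v w = 1) (ha : a 1 = 1)
    (hab : ∀ k, a k + b k = 1) {W : Finset V} {v : V} (hv : v ∈ W) :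
    goodMass P a W + ∑' l : List V, (if IsStack W v l then
      pathProb P v l * (b l.length * goodMass P a (W \ l.toFinset)) else 0) ≤
      goodMass P a (W.erase v) := by
  have h1 : goodMass P a (W.erase v) =
      mapSum P W fun φ => accepted a (cycles (reset φ [v])) := by
    -- The pinned vertex is given a dummy choice of image, of total mass 1, so that both sides
    -- become sums over the same random maps on `W`.
    rw [← one_mul (goodMass P a (W.erase v)), ← hP v, Finset.sum_mul]
    simp only [goodMass]
    simp only [← mapSum_reset_vertex P hv]
    rw [← mapSum_finset_sum]
    exact mapSum_congr fun φ _ => by simp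
  have h2 : ∀ l : List V, (if IsStack W v l then
      pathProb P v l * (b l.length * goodMass P a (W \ l.toFinset)) else 0) =
      mapSum P W fun φ => if IsStack W v l ∧ Traces φ v l then
        b l.length * accepted a (cycles (reset φ l)) else 0 := by
    intro l
    by_cases hl : IsStack W v l
    · simp only [hl, true_and, if_true]
      rw [goodMass, ← mapSum_const_mul, ← mapSum_reset P hl.1 hl.2.1]
    · simp [hl, mapSum]
  rw [h1, tsum_congr h2, ← mapSum_tsum, goodMass, ← mapSum_add]
  exact mapSum_mono fun φ _ => accepted_add_tsum_le ha hab W v φ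

end Identities

/-! ### Occupation measure of the cycle-erased walk and the cost of a walk -/

section Green

variable {V : Type*} [Fintype V] [DecidableEq V]

open Classical in
/-- Up to the factor `goodMass P a U`, the expected number of times at which the walk in `U` started
at `v` has the stack `l`. -/
noncomputable def occupation (P : V → V → ℝ≥0∞) (a : ℕ → ℝ≥0∞) (U : Finset V) (v : V) :
    List V → ℝ≥0∞
  | [] => 0
  | u :: l => if IsStack U v (u :: l) then
      pathProb P u l * goodMass P a (U \ (u :: l).toFinset) else 0

open Classical in
/-- Up to the factor `goodMass P a U`, the expected number of times at which the walk in `U` started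
at `v` has the stack `l` and steps to `w`. -/
noncomputable def flux (P : V → V → ℝ≥0∞) (a : ℕ → ℝ≥0∞) (U : Finset V) (v : V) (l : List V)
    (w : V) : ℝ≥0∞ :=
  if IsStack U v l then pathProb P w l * goodMass P a (U \ l.toFinset) else 0

/-- The mean of `R l w` over the step from the end of the stack `l` to `w`. -/
noncomputable def stepMean (P : V → V → ℝ≥0∞) (R : List V → V → ℝ≥0∞) : List V → ℝ≥0∞
  | [] => 0
  | u :: l => ∑ w, P u w * R (u :: l) w

/-- The stack from which a walk with stack `l` that steps to `w` goes on, weighted with the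
probability that it goes on. -/
noncomputable def walkKernel (b : ℕ → ℝ≥0∞) (U : Finset V) (F : List V → ℝ≥0∞) (l : List V)
    (w : V) : ℝ≥0∞ :=
  if w ∈ l then b (cycleLength l w) * F (l.drop (l.idxOf w)) else if w ∈ U then F (w :: l) else 0

variable {P : V → V → ℝ≥0∞} {a b : ℕ → ℝ≥0∞} {U : Finset V} {v : V}

theorem not_isStack_nil : ¬ IsStack U v [] := fun h => by simpa using h.2.2

theorem occupation_mul_eq_flux (u w : V) (l : List V) :
    occupation P a U v (u :: l) * P u w = flux P a U v (u :: l) w := by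
  simp only [occupation, flux, pathProb]
  split_ifs
  · ring
  · simp

theorem tsum_occupation_mul_stepMean (R : List V → V → ℝ≥0∞) :
    ∑' l, occupation P a U v l * stepMean P R l =
      ∑' q : List V × V, flux P a U v q.1 q.2 * R q.1 q.2 := by
  rw [ENNReal.tsum_prod']
  refine tsum_congr fun l => ?_
  rw [tsum_fintype]
  rcases l with _ | ⟨u, l⟩
  · simp [stepMean, flux, not_isStack_nil]
  · simp only [stepMean, Finset.mul_sum, ← mul_assoc, occupation_mul_eq_flux]

theorem IsStack.of_append {c m : List V} (h : IsStack U v (c ++ m)) (hm : m ≠ []) :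
    IsStack U v m := by
  refine ⟨h.1.sublist (List.sublist_append_right c m), fun x hx => h.2.1 x (by simp [hx]), ?_⟩
  have := h.2.2
  rwa [List.getLast?_append_of_ne_nil c hm] at this

theorem IsStack.cons {l : List V} (h : IsStack U v l) {w : V} (hw : w ∉ l) (hwU : w ∈ U) :
    IsStack U v (w :: l) := by
  refine ⟨List.nodup_cons.2 ⟨hw, h.1⟩, ?_, ?_⟩
  · intro x hx
    rcases List.mem_cons.1 hx with rfl | hx
    · exact hwU
    · exact h.2.1 x hx
  · have h2 := h.2.2
    rcases l with _ | ⟨u, l⟩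
    · simp at h2
    · simpa using h2

theorem isStack_singleton (hv : v ∈ U) : IsStack U v [v] := by
  refine ⟨by simp, ?_, by simp⟩
  intro x hx
  rw [List.mem_singleton] at hx
  exact hx ▸ hv

open Classical in
/-- The mass that flows into the stack `m` is at most the occupation of `m`. -/
theorem inflow_le_occupation (hP : ∀ v, ∑ w, P v w = 1) (ha : a 1 = 1)
    (hab : ∀ k, a k + b k = 1) (hv : v ∈ U) (x : V) (l : List V) :
    (if x :: l = [v] then goodMass P a U else 0) +
      (if x ∉ l ∧ x ∈ U then flux P a U v l x else 0) +
      ∑' c : List V, flux P a U v (c ++ x :: l) x * b (c.length + 1) ≤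
      occupation P a U v (x :: l) := by
  by_cases hm : IsStack U v (x :: l)
  · have h1 : (if x :: l = [v] then goodMass P a U else 0) +
        (if x ∉ l ∧ x ∈ U then flux P a U v l x else 0) ≤
        pathProb P x l * goodMass P a (U \ l.toFinset) := by
      rcases l with _ | ⟨u, l⟩
      · have hx : x = v := by simpa using hm.2.2
        simp [hx, flux, not_isStack_nil, pathProb]
      · rw [if_neg (by simp), zero_add]
        split_ifs with h
        · rw [flux]
          split_ifs
          · exact le_rfl
          · exact zero_le
        · exact zero_le
    have hxl : x ∉ l := (List.nodup_cons.1 hm.1).1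
    have hxU : x ∈ U \ l.toFinset := by
      simp only [Finset.mem_sdiff, List.mem_toFinset]
      exact ⟨hm.2.1 x (by simp), hxl⟩
    -- A rejected cycle that returns the walk to `x :: l` has the stack `c ++ [x]` in `U \
    -- l.toFinset`. So `goodMass_add_tsum_le`, applied to that set and to `x`, absorbs the returns.
    have h2 : ∑' c : List V, flux P a U v (c ++ x :: l) x * b (c.length + 1) ≤
        pathProb P x l * ∑' c : List V, (if IsStack (U \ l.toFinset) x c then
          pathProb P x c * (b c.length * goodMass P a ((U \ l.toFinset) \ c.toFinset)) else 0) := by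
      rw [← ENNReal.tsum_mul_left]
      have hinj : Function.Injective (fun c : List V => c ++ [x]) :=
        List.append_left_injective [x]
      refine le_trans (ENNReal.tsum_le_tsum fun c => ?_)
        (ENNReal.tsum_comp_le_tsum_of_injective hinj _)
      rw [flux]
      split_ifs with h3 h4
      · rw [pathProb_append, List.length_append, List.length_singleton]
        have : U \ (c ++ x :: l).toFinset = (U \ l.toFinset) \ (c ++ [x]).toFinset := by
          ext z
          simp only [Finset.mem_sdiff, List.mem_toFinset, List.mem_append, List.mem_cons]
          simp only [List.not_mem_nil, or_false]
          tauto
        rw [this]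
        exact le_of_eq (by ring)
      · refine absurd ⟨?_, ?_, by simp⟩ h4
        · have : List.Sublist (c ++ [x]) (c ++ x :: l) := by simp
          exact h3.1.sublist this
        · intro z hz
          simp only [Finset.mem_sdiff, List.mem_toFinset]
          refine ⟨h3.2.1 z (by simp at hz ⊢; tauto), fun hzl => ?_⟩
          have hd := h3.1
          rw [show c ++ x :: l = (c ++ [x]) ++ l by simp, List.nodup_append] at hd
          exact hd.2.2 z hz z hzl rfl
      · simp
      · simp
    rw [occupation, if_pos hm]
    have h3 : U \ (x :: l).toFinset = (U \ l.toFinset).erase x := by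
      ext z; simp only [List.toFinset_cons, Finset.mem_sdiff, Finset.mem_insert,
        Finset.mem_erase]; tauto
    rw [h3]
    refine le_trans (add_le_add h1 h2) ?_
    rw [← mul_add]
    gcongr
    exact goodMass_add_tsum_le hP ha hab hxU
  · have h1 : x :: l ≠ [v] := fun h => hm (h ▸ isStack_singleton hv)
    have h2 : (if x ∉ l ∧ x ∈ U then flux P a U v l x else 0) = 0 := by
      split_ifs with h
      · rw [flux, if_neg fun hl => hm (hl.cons h.1 h.2)]
      · rfl
    have h3 : ∀ c : List V, flux P a U v (c ++ x :: l) x * b (c.length + 1) = 0 := by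
      intro c
      rw [flux, if_neg fun hl => hm (hl.of_append (by simp)), zero_mul]
    simp [h1, h2, h3]

theorem drop_idxOf {l : List V} {w : V} (hw : w ∈ l) :
    ∃ t, l.drop (l.idxOf w) = w :: t := by
  have h := List.idxOf_lt_length_of_mem hw
  rw [List.drop_eq_getElem_cons h]
  exact ⟨_, by rw [List.getElem_idxOf h]⟩

open Classical in
/-- The mass balance of the walk. -/
theorem occupation_balance (hP : ∀ v, ∑ w, P v w = 1) (ha : a 1 = 1)
    (hab : ∀ k, a k + b k = 1) (hv : v ∈ U) (F : List V → ℝ≥0∞) :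
    goodMass P a U * F [v] +
      ∑' l, occupation P a U v l * stepMean P (walkKernel b U F) l ≤
      ∑' l, occupation P a U v l * F l := by
  rw [tsum_occupation_mul_stepMean]
  have hcons : Function.Injective (fun q : List V × V => q.2 :: q.1) := by
    rintro ⟨l, w⟩ ⟨l', w'⟩ h
    simp only [List.cons.injEq] at h
    exact Prod.ext h.2 h.1
  have hR : ∑' q : List V × V, occupation P a U v (q.2 :: q.1) * F (q.2 :: q.1) ≤
      ∑' l, occupation P a U v l * F l :=
    ENNReal.tsum_comp_le_tsum_of_injective hcons fun l => occupation P a U v l * F l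
  refine le_trans ?_ hR
  have h1 : goodMass P a U * F [v] ≤ ∑' q : List V × V,
      (if q.2 :: q.1 = [v] then goodMass P a U else 0) * F (q.2 :: q.1) := by
    refine le_trans (le_of_eq ?_) (ENNReal.le_tsum ([], v))
    simp
  have h2 : ∑' q : List V × V, flux P a U v q.1 q.2 * walkKernel b U F q.1 q.2 =
      ∑' q : List V × V,
        (if q.2 ∉ q.1 ∧ q.2 ∈ U then flux P a U v q.1 q.2 else 0) * F (q.2 :: q.1) +
      ∑' q : List V × V, (if q.2 ∈ q.1 then
        flux P a U v q.1 q.2 * b (cycleLength q.1 q.2) * F (q.1.drop (q.1.idxOf q.2)) else 0) := by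
    rw [← ENNReal.tsum_add]
    refine tsum_congr fun q => ?_
    by_cases h : q.2 ∈ q.1 <;> by_cases h' : q.2 ∈ U <;> simp [walkKernel, h, h', mul_assoc]
  have h3 : ∑' q : List V × V, (if q.2 ∈ q.1 then
        flux P a U v q.1 q.2 * b (cycleLength q.1 q.2) * F (q.1.drop (q.1.idxOf q.2)) else 0) ≤
      ∑' q : List V × V, (∑' c : List V, flux P a U v (c ++ q.2 :: q.1) q.2 * b (c.length + 1)) *
        F (q.2 :: q.1) := by
    simp only [← ENNReal.tsum_mul_right]
    rw [← ENNReal.tsum_prod (f := fun (q : List V × V) (c : List V) =>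
      flux P a U v (c ++ q.2 :: q.1) q.2 * b (c.length + 1) * F (q.2 :: q.1))]
    rw [← tsum_subtype_eq_of_support_subset (s := {q : List V × V | q.2 ∈ q.1})
      (fun q hq => by
        by_contra h
        exact hq (if_neg h))]
    -- A step that closes a cycle is reindexed by the stack it falls back to, `w :: t`, and the part
    -- `c` erased above it.
    let i : {q : List V × V | q.2 ∈ q.1} → (List V × V) × List V := fun q =>
      (((q.1.1.drop (q.1.1.idxOf q.1.2)).tail, q.1.2), q.1.1.take (q.1.1.idxOf q.1.2))
    have hi : ∀ q : {q : List V × V | q.2 ∈ q.1}, (i q).1.2 :: (i q).1.1 =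
        q.1.1.drop (q.1.1.idxOf q.1.2) := by
      intro q
      obtain ⟨t, ht⟩ := drop_idxOf q.2
      simp only [i, ht, List.tail_cons]
    have hi' : ∀ q : {q : List V × V | q.2 ∈ q.1}, (i q).2 ++ (i q).1.2 :: (i q).1.1 = q.1.1 := by
      intro q
      rw [hi]
      exact List.take_append_drop _ _
    have hinj : Function.Injective i := by
      intro q q' h
      refine Subtype.ext (Prod.ext ?_ ?_)
      · rw [← hi' q, ← hi' q', h]
      · have : (i q).1.2 = (i q').1.2 := by rw [h]
        exact this
    refine le_trans (ENNReal.tsum_le_tsum fun q => ?_)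
      (ENNReal.tsum_comp_le_tsum_of_injective hinj _)
    have hlen : (i q).2.length + 1 = cycleLength q.1.1 q.1.2 := by
      have := List.idxOf_lt_length_of_mem q.2
      simp only [i, cycleLength, List.length_take]
      omega
    simp only [hi', hlen]
    simp only [hi]
    rw [if_pos (show q.1.2 ∈ q.1.1 from q.2)]
  rw [h2]
  refine le_trans (add_le_add h1 (add_le_add le_rfl h3)) ?_
  rw [← add_assoc, ← ENNReal.tsum_add, ← ENNReal.tsum_add]
  refine ENNReal.tsum_le_tsum fun q => ?_
  rw [← add_mul, ← add_mul]
  gcongr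
  exact inflow_le_occupation hP ha hab hv q.2 q.1

theorem stepMean_walkKernel_sum {ι : Type*} (s : Finset ι) (F : ι → List V → ℝ≥0∞)
    (l : List V) : stepMean P (walkKernel b U fun l => ∑ i ∈ s, F i l) l =
      ∑ i ∈ s, stepMean P (walkKernel b U (F i)) l := by
  rcases l with _ | ⟨u, l⟩
  · simp [stepMean]
  · simp only [stepMean]
    rw [Finset.sum_comm]
    refine Finset.sum_congr rfl fun w _ => ?_
    rw [← Finset.mul_sum]
    congr 1
    simp only [walkKernel]
    split_ifs <;> simp [Finset.mul_sum]

theorem stepMean_mono {R R' : List V → V → ℝ≥0∞} {l : List V} (h : ∀ w, R l w ≤ R' l w) :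
    stepMean P R l ≤ stepMean P R' l := by
  rcases l with _ | ⟨u, l⟩
  · exact le_rfl
  · exact Finset.sum_le_sum fun w _ => mul_le_mul_right (h w) _

theorem walkKernel_mono {F F' : List V → ℝ≥0∞} {l : List V} (hl : IsStack U v l)
    (h : ∀ m, IsStack U v m → F m ≤ F' m) (w : V) :
    walkKernel b U F l w ≤ walkKernel b U F' l w := by
  simp only [walkKernel]
  split_ifs with h1 h2
  · gcongr
    refine h _ (IsStack.of_append (c := l.take (l.idxOf w)) (by simpa using hl) ?_)
    obtain ⟨t, ht⟩ := drop_idxOf h1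
    simp [ht]
  · exact h _ (hl.cons h1 h2)
  · exact le_rfl

/-- The expected cost of a walk, if every step of it from the stack `l` to `w` costs `R l w`. -/
theorem goodMass_mul_cost_le (hP : ∀ v, ∑ w, P v w = 1) (ha : a 1 = 1)
    (hab : ∀ k, a k + b k = 1) (hv : v ∈ U) (R : List V → V → ℝ≥0∞) (X : ℕ → List V → ℝ≥0∞)
    (h0 : ∀ l, IsStack U v l → X 0 l = 0)
    (hX : ∀ T l, IsStack U v l →
      X (T + 1) l ≤ stepMean P (fun l w => R l w + walkKernel b U (X T) l w) l) (T : ℕ) :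
    goodMass P a U * X T [v] ≤ ∑' q : List V × V, flux P a U v q.1 q.2 * R q.1 q.2 := by
  let K : (List V → ℝ≥0∞) → List V → ℝ≥0∞ := fun F => stepMean P (walkKernel b U F)
  let Y : ℕ → List V → ℝ≥0∞ := fun t => K^[t] (stepMean P R)
  have hY : ∀ t, Y (t + 1) = K (Y t) := fun t => Function.iterate_succ_apply' K t _
  have h1 : ∀ T l, IsStack U v l → X T l ≤ ∑ t ∈ Finset.range T, Y t l := by
    intro T
    induction T with
    | zero => intro l hl; simp [h0 l hl]
    | succ T ih =>
      intro l hl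
      have h2 : X (T + 1) l ≤ stepMean P R l +
          K (fun l => ∑ t ∈ Finset.range T, Y t l) l := by
        refine (hX T l hl).trans (le_trans (stepMean_mono (R' := fun l w => R l w +
          walkKernel b U (fun l => ∑ t ∈ Finset.range T, Y t l) l w) fun w =>
          add_le_add le_rfl (walkKernel_mono hl ih w)) (le_of_eq ?_))
        rcases l with _ | ⟨u, l⟩
        · simp [stepMean, K]
        · simp only [stepMean, mul_add, Finset.sum_add_distrib, K]
      refine h2.trans (le_of_eq ?_)
      rw [Finset.sum_range_succ', add_comm]
      simp only [hY]
      simp only [K]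
      rw [stepMean_walkKernel_sum]
      rfl
  -- Iterating the balance moves mass from the occupation term to the accumulated cost; the
  -- remaining term is nonnegative and is dropped, so no convergence is needed.
  have h2 : ∀ T, goodMass P a U * ∑ t ∈ Finset.range T, Y t [v] +
      ∑' l, occupation P a U v l * Y T l ≤ ∑' l, occupation P a U v l * Y 0 l := by
    intro T
    induction T with
    | zero => simp
    | succ T ih =>
      refine le_trans ?_ ih
      rw [Finset.sum_range_succ, mul_add, add_assoc, hY]
      gcongr
      exact occupation_balance hP ha hab hv (Y T)
  rw [← tsum_occupation_mul_stepMean]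
  refine le_trans ?_ (h2 T)
  refine le_trans ?_ le_self_add
  gcongr
  exact h1 T [v] (isStack_singleton hv)

/-- A bound for the expected number of operations of the sampler that enters the outer loop with the
set `W` of unfixed vertices. -/
noncomputable def potential (P : V → V → ℝ≥0∞) (a b : ℕ → ℝ≥0∞) (W : Finset V) : ℝ≥0∞ :=
  if goodMass P a W = 0 then ⊤ else
    1 + 5 * W.card + 4 * (badMass P a b W / goodMass P a W)

theorem goodMass_ne_top (hP : ∀ v, ∑ w, P v w = 1) (ha : ∀ k, a k ≤ 1) (W : Finset V) :
    goodMass P a W ≠ ⊤ := by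
  refine ENNReal.sum_ne_top.2 fun φ _ => ?_
  split_ifs
  · have h1 : ∀ v w, P v w ≤ 1 := fun v w => by
      rw [← hP v]; exact Finset.single_le_sum (f := P v) (fun _ _ => zero_le) (Finset.mem_univ w)
    refine ENNReal.mul_ne_top ?_ ?_
    · exact ne_top_of_le_ne_top ENNReal.one_ne_top (Finset.prod_le_one' fun v _ => h1 _ _)
    · exact ne_top_of_le_ne_top ENNReal.one_ne_top (Finset.prod_le_one' fun v _ => ha _)
  · simp

/-- The value `⊤` of the potential at mass zero does no harm, since `0 * ⊤ = 0`: sets that cannot be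
completed get no weight. -/
theorem goodMass_mul_potential_le (hP : ∀ v, ∑ w, P v w = 1) (ha : ∀ k, a k ≤ 1) (W : Finset V) :
    goodMass P a W * potential P a b W ≤
      goodMass P a W * (1 + 5 * W.card) + 4 * badMass P a b W := by
  rw [potential]
  split_ifs with h
  · simp [h]
  · rw [mul_add, mul_left_comm, ENNReal.mul_div_cancel h (goodMass_ne_top hP ha W)]

open Classical in
/-- The expected cost of one walk and of all that follows it. -/
theorem walk_cost_le_potential (hP : ∀ v, ∑ w, P v w = 1) (ha : a 1 = 1) (hb : b 1 = 0)
    (hab : ∀ k, a k + b k = 1) (hv : v ∈ U) (X : ℕ → List V → ℝ≥0∞)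
    (h0 : ∀ l, IsStack U v l → X 0 l = 0)
    (hX : ∀ T l, IsStack U v l → X (T + 1) l ≤ stepMean P (fun l w =>
      (if w ∈ l ∨ w ∉ U then stopProb a l w * (5 * l.length + potential P a b (U \ l.toFinset)) +
        4 * rejectedLength b l w else 0) + walkKernel b U (X T) l w) l) (T : ℕ) :
    X T [v] ≤ potential P a b U := by
  have ha1 : ∀ k, a k ≤ 1 := fun k => hab k ▸ le_self_add
  rw [potential]
  split_ifs with hZ
  · exact le_top
  have hZ' := goodMass_ne_top (P := P) hP ha1 U
  have h1 := goodMass_mul_cost_le hP ha hab hv _ X h0 hX T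
  rw [← ENNReal.mul_le_mul_iff_right hZ hZ', mul_add, mul_left_comm,
    ENNReal.mul_div_cancel hZ hZ']
  refine h1.trans ?_
  -- The flux carries the factor `goodMass` of the remaining set, which cancels the denominator of
  -- its potential. The `5 * l.length` for the recorded walk and the `5` per remaining vertex add up
  -- to `5 * U.card`.
  have h2 : ∀ q : List V × V, flux P a U v q.1 q.2 *
      (if q.2 ∈ q.1 ∨ q.2 ∉ U then stopProb a q.1 q.2 *
        (5 * q.1.length + potential P a b (U \ q.1.toFinset)) +
        4 * rejectedLength b q.1 q.2 else 0) ≤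
      (if IsStack U v q.1 ∧ (q.2 ∈ q.1 ∨ q.2 ∉ U) then
        pathProb P q.2 q.1 * (stopProb a q.1 q.2 * goodMass P a (U \ q.1.toFinset)) else 0) *
        (1 + 5 * U.card) +
      4 * (if IsStack U v q.1 ∧ (q.2 ∈ q.1 ∨ q.2 ∉ U) then
        pathProb P q.2 q.1 * (stopProb a q.1 q.2 * badMass P a b (U \ q.1.toFinset) +
        rejectedLength b q.1 q.2 * goodMass P a (U \ q.1.toFinset)) else 0) := by
    rintro ⟨l, w⟩
    simp only [flux]
    by_cases hl : IsStack U v l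
    · by_cases hw : w ∈ l ∨ w ∉ U
      · simp only [hl, hw, and_self, if_true]
        have hsub : l.toFinset ⊆ U := fun x hx => hl.2.1 x (List.mem_toFinset.1 hx)
        have hcard : (U.card : ℝ≥0∞) = l.length + (U \ l.toFinset).card := by
          rw [← List.toFinset_card_of_nodup hl.1, ← Nat.cast_add, add_comm,
            Finset.card_sdiff_add_card_eq_card hsub]
        have hpot := goodMass_mul_potential_le (b := b) (P := P) hP ha1 (U \ l.toFinset)
        set g := goodMass P a (U \ l.toFinset)
        set B := badMass P a b (U \ l.toFinset)
        set ψ := potential P a b (U \ l.toFinset)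
        calc pathProb P w l * g * (stopProb a l w * (5 * l.length + ψ) + 4 * rejectedLength b l w)
            = pathProb P w l * (stopProb a l w * (g * (5 * l.length) + g * ψ) +
              4 * (rejectedLength b l w * g)) := by ring
          _ ≤ pathProb P w l * (stopProb a l w * (g * (5 * l.length) +
              (g * (1 + 5 * (U \ l.toFinset).card) + 4 * B)) +
              4 * (rejectedLength b l w * g)) := by gcongr
          _ = _ := by rw [hcard]; ring
      · simp [hw]
    · simp [hl]
  refine (ENNReal.tsum_le_tsum h2).trans ?_
  rw [ENNReal.tsum_add, ENNReal.tsum_mul_right, ENNReal.tsum_mul_left]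
  gcongr
  · exact tsum_stop_goodMass_le ha U v
  · exact tsum_stop_badMass_le ha hb U v

end Green

/-! ### Reversing a path of a map -/

section Paths

variable {V : Type*} [DecidableEq V]

theorem exists_traces_of_nodup (φ : V → V) (y : V) {p : List V} (hp : p.Nodup) :
    ∃ ψ : V → V, (∀ z ∉ p, ψ z = φ z) ∧ Traces ψ y p := by
  induction p generalizing y with
  | nil => exact ⟨φ, fun _ _ => rfl, trivial⟩
  | cons u p ih =>
    obtain ⟨hu, hp⟩ := List.nodup_cons.1 hp
    obtain ⟨ψ, h1, h2⟩ := ih u hp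
    refine ⟨Function.update ψ u y, fun z hz => ?_, by simp, ?_⟩
    · rw [List.mem_cons, not_or] at hz
      rw [Function.update_of_ne hz.1, h1 z hz.2]
    · refine (Traces.congr fun x hx => ?_).2 h2
      exact Function.update_of_ne (fun h : x = u => hu (h ▸ hx)) _ _

theorem Traces.reverse_apply {φ ψ : V → V} {v x y : V} {t : List V}
    (h : Traces φ v (x :: t).reverse) (h' : Traces ψ y (x :: t)) :
    ∀ z ∈ x :: t, (z = x ∧ ψ z = y) ∨ φ (ψ z) = z := by
  induction t generalizing x y with
  | nil =>
    intro z hz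
    rw [List.mem_singleton] at hz
    exact Or.inl ⟨hz, hz ▸ h'.1⟩
  | cons x₁ t ih =>
    intro z hz
    rcases List.mem_cons.1 hz with rfl | hz
    · exact Or.inl ⟨rfl, h'.1⟩
    · rw [List.reverse_cons, List.reverse_cons, List.append_assoc, List.singleton_append,
        Traces.append] at h
      rcases ih (by rw [List.reverse_cons]; exact h.1) h'.2 z hz with h1 | h1
      · right
        rw [h1.2, h1.1]
        exact h.2.1
      · exact Or.inr h1

theorem nodup_orbitStack {φ : V → V} {v : V} {k : ℕ}
    (h : ∀ i j, i < j → j < k → φ^[i] v ≠ φ^[j] v) : (orbitStack φ v k).Nodup := by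
  induction k with
  | zero => exact List.nodup_nil
  | succ k ih =>
    refine List.nodup_cons.2 ⟨fun hk => ?_, ih fun i j hij hj => h i j hij (by omega)⟩
    obtain ⟨i, hi, hik⟩ := mem_orbitStack.1 hk
    exact h i k hi (by omega) hik

/-- A map has only one path between two given vertices. -/
theorem Traces.path_unique {ψ : V → V} {u x y y' : V} {t t' : List V}
    (h : Traces ψ y (x :: t)) (hl : (x :: t).getLast? = some u) (hn : (x :: t).Nodup)
    (h' : Traces ψ y' (x :: t')) (hl' : (x :: t').getLast? = some u) (hn' : (x :: t').Nodup) :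
    t = t' := by
  have split : ∀ {y : V} {t : List V}, Traces ψ y (x :: t) → (x :: t).getLast? = some u →
      x = ψ^[t.length] u ∧ t = orbitStack ψ u t.length := by
    intro y t h hl
    have e := (h.eq_orbitStack hl).1
    rwa [List.length_cons, orbitStack, List.cons.injEq] at e
  have nlt : ∀ {t t' : List V}, x = ψ^[t.length] u → t' = orbitStack ψ u t'.length →
      (x :: t').Nodup → ¬ t.length < t'.length := by
    intro t t' hx ht' hn hlt
    refine (List.nodup_cons.1 hn).1 ?_
    rw [ht', mem_orbitStack]
    exact ⟨_, hlt, hx.symm⟩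
  obtain ⟨h1, h2⟩ := split h hl
  obtain ⟨h1', h2'⟩ := split h' hl'
  have hlen : t.length = t'.length :=
    le_antisymm (not_lt.1 (nlt h1' h2 hn)) (not_lt.1 (nlt h1 h2' hn'))
  rw [h2, h2', hlen]

end Paths

/-! ### Removing a 2-cycle -/

section Surgery

variable {V : Type*} [Fintype V] [DecidableEq V]

/-- The map `ψ` arises from `φ` by removing the 2-cycle `C` and reversing a path from `x` to `C`:
at most one new cycle appears, and it runs through `x` and has length at least 3. The vertex `v` is
the one of `C` off the path. -/
structure Surgery (φ : V → V) (C : Finset V) (ψ : V → V) (x v : V) : Prop where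
  erase_subset : (cycles φ).erase C ⊆ cycles ψ
  mem_or : ∀ D ∈ cycles ψ, D ∈ (cycles φ).erase C ∨ (x ∈ D ∧ 3 ≤ D.card)
  path : ∃ y t, (x :: t).Nodup ∧ (x :: t).getLast? = some (ψ v) ∧ Traces ψ y (x :: t) ∧
    Traces φ v (x :: t).reverse ∧ ∀ z ∉ x :: t, ψ z = φ z
  pair : C = {ψ v, v}

/-- From `ψ`, `x` and `v` one recovers the end `ψ v` of the reversed path, then the path itself as
the only simple `ψ`-path from there to `x`; turning it round gives back `φ`. -/
theorem Surgery.injective {φ φ' : V → V} {C C' : Finset V} {ψ : V → V} {x v : V}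
    (h : Surgery φ C ψ x v) (h' : Surgery φ' C' ψ x v) : φ = φ' ∧ C = C' := by
  refine ⟨?_, h.pair.trans h'.pair.symm⟩
  obtain ⟨y, t, hn, hl, ht, hr, hψ⟩ := h.path
  obtain ⟨y', t', hn', hl', ht', hr', hψ'⟩ := h'.path
  obtain rfl := Traces.path_unique ht hl hn ht' hl' hn'
  funext z
  by_cases hz : z ∈ x :: t
  · exact Traces.eqOn hr hr' z (List.mem_reverse.2 hz)
  · rw [← hψ z hz, ← hψ' z hz]

/-- If every vertex runs into `C`, then `φ` uses at most $n-1$ edges, because the two arcs of the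
2-cycle share one, and some edge is left over. Otherwise connectedness gives an edge from the basin
of `C` to its complement, and using it in either direction would put its outer end into the basin.
-/
theorem exists_edge_of_basin {G : SimpleGraph V} [DecidableRel G.Adj] (hG : G.Connected)
    (hE : Fintype.card V ≤ G.edgeFinset.card) {φ : V → V} {C : Finset V} (hC : IsCycle φ C)
    {u v : V} (hu : u ∈ C) (huv : u ≠ v) (h1 : φ u = v) (h2 : φ v = u) :
    ∃ x y k, φ^[k] x ∈ C ∧ G.Adj x y ∧ φ x ≠ y ∧ φ y ≠ x := by
  by_cases hA : ∀ z, ∃ k, φ^[k] z ∈ C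
  · have hcard : ((Finset.univ.erase v).image fun z => s(z, φ z)).card < G.edgeFinset.card := by
      refine lt_of_le_of_lt Finset.card_image_le ?_
      rw [Finset.card_erase_of_mem (Finset.mem_univ v), Finset.card_univ]
      have := Fintype.card_pos_iff.2 ⟨v⟩
      omega
    obtain ⟨e, he, he'⟩ := Finset.exists_mem_notMem_of_card_lt_card hcard
    have hne : ∀ z, s(z, φ z) ≠ e := by
      intro z hz
      refine he' (Finset.mem_image.2 ?_)
      by_cases hzv : z = v
      · refine ⟨u, by simp [huv], ?_⟩
        rw [← hz, hzv, h1, h2, Sym2.eq_swap]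
      · exact ⟨z, by simp [hzv], hz⟩
    induction e with
    | h x y =>
      obtain ⟨k, hk⟩ := hA x
      refine ⟨x, y, k, hk, by simpa using he, fun h => hne x (by rw [h]), fun h => hne y ?_⟩
      rw [h, Sym2.eq_swap]
  · push Not at hA
    obtain ⟨z, hz⟩ := hA
    obtain ⟨p⟩ := hG.preconnected u z
    obtain ⟨d, -, ⟨k, hd⟩, hd'⟩ := p.exists_boundary_dart {z | ∃ k, φ^[k] z ∈ C} ⟨0, hu⟩
      fun ⟨k, hk⟩ => hz k hk
    refine ⟨d.fst, d.snd, k, hd, d.adj, fun h => hd' ⟨k, ?_⟩, fun h => hd' ⟨k + 1, ?_⟩⟩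
    · rw [← h, ← Function.iterate_succ_apply, Function.iterate_succ_apply']
      exact hC.map_mem hd
    · rw [Function.iterate_succ_apply, h]
      exact hd

/-- The path from `x` to its first vertex `u` in `C` is reversed and `x` is sent to `y`, along the
unused edge. The whole basin of `C` then runs into `x`, so a new cycle must pass through `x` and
`y`. It is not a 2-cycle, since the edge was unused in both directions. -/
theorem exists_surgery {G : SimpleGraph V} [DecidableRel G.Adj] (hG : G.Connected)
    (hE : Fintype.card V ≤ G.edgeFinset.card) {φ : V → V} (hφ : ∀ z, G.Adj z (φ z))
    {C : Finset V} (hC : C ∈ cycles φ) (hC2 : C.card = 2) :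
    ∃ ψ x v, Surgery φ C ψ x v ∧ ∀ z, G.Adj z (ψ z) := by
  classical
  have hC := mem_cycles.1 hC
  have hpair : ∀ u ∈ C, C = {u, φ u} ∧ φ (φ u) = u := by
    intro u hu
    have hne : u ≠ φ u := (hφ u).ne
    have e : {u, φ u} = C := by
      refine Finset.eq_of_subset_of_card_le ?_ ?_
      · intro z hz
        simp only [Finset.mem_insert, Finset.mem_singleton] at hz
        rcases hz with rfl | rfl
        · exact hu
        · exact hC.map_mem hu
      · rw [Finset.card_pair hne, hC2]
    refine ⟨e.symm, ?_⟩
    have h3 := hC.map_mem (hC.map_mem hu)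
    rw [← e] at h3
    simp only [Finset.mem_insert, Finset.mem_singleton] at h3
    exact h3.resolve_right (hφ (φ u)).ne'
  obtain ⟨u₀, hu₀⟩ := hC.nonempty
  obtain ⟨x, y, k, hk, hxy, hxy1, hxy2⟩ := exists_edge_of_basin hG hE hC hu₀ (hφ u₀).ne rfl
    (hpair u₀ hu₀).2
  have hex : ∃ k, φ^[k] x ∈ C := ⟨k, hk⟩
  obtain ⟨m, hm, hmin⟩ : ∃ m, φ^[m] x ∈ C ∧ ∀ i < m, φ^[i] x ∉ C :=
    ⟨Nat.find hex, Nat.find_spec hex, fun i hi => Nat.find_min hex hi⟩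
  set u := φ^[m] x with hu
  have hn : (orbitStack φ x (m + 1)).Nodup := by
    -- A repetition at times `i < j` would bring the orbit into `C` already at time `m - (j - i)`.
    refine nodup_orbitStack fun i j hij hj he => hmin (m - j + i) (by omega) ?_
    rw [Function.iterate_add_apply, he, ← Function.iterate_add_apply,
      show m - j + j = m by omega]
    exact hm
  have hlast : (orbitStack φ x (m + 1)).getLast? = some x := by
    clear_value u
    clear hn hm hmin hu
    induction m with
    | zero => simp [orbitStack]
    | succ m ih => rw [orbitStack, List.getLast?_cons, ih]; simp
  obtain ⟨t, ht⟩ : ∃ t, (orbitStack φ x (m + 1)).reverse = x :: t := by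
    obtain ⟨l, hl⟩ := List.getLast?_eq_some_iff.1 hlast
    exact ⟨l.reverse, by rw [hl]; simp⟩
  have hrev : (x :: t).reverse = orbitStack φ x (m + 1) := by rw [← ht, List.reverse_reverse]
  have hmem : ∀ z, z ∈ x :: t ↔ ∃ i < m + 1, φ^[i] x = z := by
    intro z; rw [← ht, List.mem_reverse, mem_orbitStack]
  have hnd : (x :: t).Nodup := by rw [← ht]; exact List.nodup_reverse.2 hn
  have htr : Traces φ (φ u) (x :: t).reverse := by
    rw [hrev, hu, ← Function.iterate_succ_apply' φ m x]
    exact traces_orbitStack φ x (m + 1)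
  have hlu : (x :: t).getLast? = some u := by
    rw [← ht, List.getLast?_reverse]; rfl
  have hv : φ u ∉ x :: t := by
    rw [hmem]
    rintro ⟨i, hi, hiu⟩
    rcases Nat.lt_succ_iff_lt_or_eq.1 hi with hi | rfl
    · exact hmin i hi (hiu ▸ hC.map_mem hm)
    · exact (hφ u).ne hiu
  obtain ⟨ψ, hψ, hψt⟩ := exists_traces_of_nodup φ y hnd
  have hback := Traces.reverse_apply htr hψt
  have hadj : ∀ z, G.Adj z (ψ z) := by
    intro z
    by_cases hz : z ∈ x :: t
    · rcases hback z hz with h | h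
      · obtain ⟨rfl, h⟩ := h
        rw [h]
        exact hxy
      · have := hφ (ψ z)
        rw [h] at this
        exact this.symm
    · rw [hψ z hz]; exact hφ z
  have hψv : ψ (φ u) = u := by rw [hψ _ hv, (hpair u hm).2]
  -- every vertex of the basin of `C` runs to `x` under `ψ`
  have hreach_path : ∀ z ∈ x :: t, ∃ k, ψ^[k] z = x := by
    intro z hz
    rcases List.mem_cons.1 hz with rfl | hz
    · exact ⟨0, rfl⟩
    · exact Traces.exists_iterate hψt.2 hz
  have hreach : ∀ k z, φ^[k] z = u → ∃ k, ψ^[k] z = x := by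
    intro k
    induction k with
    | zero =>
      rintro z hz
      exact hreach_path z ((hmem z).2 ⟨m, by omega, hz.symm⟩)
    | succ k ih =>
      intro z hz
      by_cases hzt : z ∈ x :: t
      · exact hreach_path z hzt
      · obtain ⟨i, hi⟩ := ih (φ z) hz
        exact ⟨i + 1, by rw [Function.iterate_succ_apply, hψ z hzt, hi]⟩
  let A : Finset V := Finset.univ.filter fun z => ∃ k, φ^[k] z = u
  have hAmem : ∀ z, z ∈ A ↔ ∃ k, φ^[k] z = u := fun z => by simp [A]
  have hagree : ∀ z ∉ A, φ z = ψ z := by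
    intro z hz
    refine (hψ z fun hzt => hz ?_).symm
    obtain ⟨i, hi, rfl⟩ := (hmem z).1 hzt
    rw [hAmem]
    exact ⟨m - i, by rw [← Function.iterate_add_apply, show m - i + i = m by omega]⟩
  have hfil : (cycles φ).erase C = (cycles φ).filter (Disjoint A) := by
    ext D
    simp only [Finset.mem_erase, Finset.mem_filter, mem_cycles, and_comm (a := D ≠ C),
      and_congr_right_iff]
    intro hD
    constructor
    · intro hne
      rw [Finset.disjoint_left]
      intro z hz hzD
      obtain ⟨k, hk⟩ := (hAmem z).1 hz
      exact hne (hD.eq_of_mem hC (hk ▸ hD.iterate_mem hzD k) hm)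
    · rintro hd rfl
      exact Finset.disjoint_left.1 hd ((hAmem u).2 ⟨0, rfl⟩) hm
  rw [cycles_filter_disjoint_congr hagree] at hfil
  refine ⟨ψ, x, φ u, ⟨?_, ?_, ⟨y, t, hnd, by rw [hψv]; exact hlu, hψt, htr, hψ⟩, ?_⟩, hadj⟩
  · rw [hfil]; exact Finset.filter_subset _ _
  · intro D hD
    by_cases hd : Disjoint A D
    · left; rw [hfil]; exact Finset.mem_filter.2 ⟨hD, hd⟩
    · right
      have hD := mem_cycles.1 hD
      obtain ⟨z, hz, hzD⟩ := Finset.not_disjoint_iff.1 hd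
      obtain ⟨k, hk⟩ := (hAmem z).1 hz
      obtain ⟨i, hi⟩ := hreach k z hk
      have hxD : x ∈ D := hi ▸ hD.iterate_mem hzD i
      refine ⟨hxD, ?_⟩
      have hψx : ψ x = y := hψt.1
      have hyD : y ∈ D := hψx ▸ hD.map_mem hxD
      have hψyx : ψ y ≠ x := by
        by_cases hy : y ∈ x :: t
        · rcases hback y hy with h | h
          · exact absurd h.1 hxy.ne'
          · intro h'
            rw [h'] at h
            exact hxy1 h
        · rw [hψ y hy]; exact hxy2
      rw [show 3 = ({x, y, ψ y} : Finset V).card by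
        rw [Finset.card_eq_three.2 ⟨x, y, ψ y, hxy.ne, hψyx.symm, (hadj y).ne, rfl⟩]]
      refine Finset.card_le_card fun w hw => ?_
      simp only [Finset.mem_insert, Finset.mem_singleton] at hw
      rcases hw with rfl | rfl | rfl
      · exact hxD
      · exact hyD
      · exact hD.map_mem hyD
  · rw [hψv]; exact (hpair u hm).1

theorem Surgery.accepted_le {a : ℕ → ℝ≥0∞} (ha : ∀ k, 3 ≤ k → 1 ≤ 2 * a k) {φ ψ : V → V}
    {C : Finset V} {x v : V} (h : Surgery φ C ψ x v) :
    accepted a ((cycles φ).erase C) ≤ 2 * accepted a (cycles ψ) := by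
  by_cases hD : ∃ D ∈ cycles ψ, D ∉ (cycles φ).erase C
  · obtain ⟨D, hD, hDC⟩ := hD
    have hx := (h.mem_or D hD).resolve_left hDC
    have e : cycles ψ = insert D ((cycles φ).erase C) := by
      refine Finset.Subset.antisymm (fun E hE => ?_)
        (Finset.insert_subset hD h.erase_subset)
      rcases h.mem_or E hE with h1 | h1
      · exact Finset.mem_insert_of_mem h1
      · rw [(mem_cycles.1 hE).eq_of_mem (mem_cycles.1 hD) h1.1 hx.1]
        exact Finset.mem_insert_self _ _
    rw [e, accepted_insert hDC, ← mul_assoc]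
    exact le_mul_of_one_le_left' (ha _ hx.2)
  · push Not at hD
    rw [Finset.Subset.antisymm hD h.erase_subset, two_mul]
    exact le_self_add

end Surgery

/-! ### Comparison of the two masses for the simple random walk -/

section Bounds

variable {V : Type*} [Fintype V] [DecidableEq V]

/-- The transition probabilities of the simple random walk. -/
noncomputable def walkProb (G : SimpleGraph V) [DecidableRel G.Adj] (u w : V) : ℝ≥0∞ :=
  if G.Adj u w then (G.degree u : ℝ≥0∞)⁻¹ else 0

variable {G : SimpleGraph V} [DecidableRel G.Adj] {a b : ℕ → ℝ≥0∞}

theorem prod_walkProb_of_adj {φ : V → V} (h : ∀ z, G.Adj z (φ z)) :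
    ∏ z, walkProb G z (φ z) = ∏ z, (G.degree z : ℝ≥0∞)⁻¹ := by
  simp [walkProb, h]

theorem adj_of_prod_walkProb_ne_zero {φ : V → V} (h : ∏ z, walkProb G z (φ z) ≠ 0) (z : V) :
    G.Adj z (φ z) := by
  by_contra hz
  exact h (Finset.prod_eq_zero (Finset.mem_univ z) (by simp [walkProb, hz]))

theorem mapSum_univ (P : V → V → ℝ≥0∞) (F : (V → V) → ℝ≥0∞) :
    mapSum P Finset.univ F = ∑ φ : V → V, (∏ z, P z (φ z)) * F φ := by
  simp [mapSum]

theorem sum_card_cycles_le (φ : V → V) : ∑ C ∈ cycles φ, C.card ≤ Fintype.card V := by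
  have h := Finset.card_biUnion (s := cycles φ) (t := id) fun C hC D hD hne => by
    rw [Function.onFun, Finset.disjoint_left]
    intro x hx hx'
    exact hne ((mem_cycles.1 hC).eq_of_mem (mem_cycles.1 hD) hx hx')
  simp only [id] at h
  rw [← h]
  exact Finset.card_le_univ _

/-- For a long cycle the rejection factor is replaced by the acceptance factor, and the lengths of
disjoint cycles sum to at most $n$. For 2-cycles nothing is assumed about `a 2`, so their rejection
factor is bounded by 1. -/
theorem rejectedOne_cycles_le (hb : b 1 = 0) (hb1 : b 2 ≤ 1) (hba : ∀ k, 3 ≤ k → b k ≤ a k)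
    (φ : V → V) : rejectedOne a b (cycles φ) ≤
      Fintype.card V * accepted a (cycles φ) +
        2 * ∑ C ∈ (cycles φ).filter (fun C => C.card = 2), accepted a ((cycles φ).erase C) := by
  have h1 : ∀ C ∈ cycles φ, C.card * b C.card * accepted a ((cycles φ).erase C) ≤
      C.card * accepted a (cycles φ) +
        2 * (if C.card = 2 then accepted a ((cycles φ).erase C) else 0) := by
    intro C hC
    by_cases h2 : C.card = 2
    · refine le_trans ?_ le_add_self
      rw [if_pos h2, h2]
      gcongr
      calc ((2 : ℕ) : ℝ≥0∞) * b 2 ≤ 2 * 1 := by push_cast; gcongr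
        _ = 2 := mul_one _
    · refine le_trans ?_ le_self_add
      have hpos := (mem_cycles.1 hC).nonempty.card_pos
      by_cases h3 : C.card = 1
      · simp [h3, hb]
      · rw [← Finset.insert_erase hC, accepted_insert (Finset.notMem_erase C _),
          Finset.insert_erase hC, ← mul_assoc]
        gcongr
        exact hba _ (by omega)
  refine (Finset.sum_le_sum h1).trans ?_
  rw [Finset.sum_add_distrib, ← Finset.sum_mul, ← Finset.mul_sum, Finset.sum_filter,
    ← Nat.cast_sum]
  gcongr
  exact sum_card_cycles_le φ

/-- Surgery maps the pairs `(φ, C)` injectively to triples `(ψ, x, v)`. It preserves the walk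
weight, which is the same product of inverse degrees for all maps along edges. The free pair `(x,
v)` gives $n^2$, the possible new cycle the factor 2. -/
theorem sum_two_cycles_le (hG : G.Connected) (hE : Fintype.card V ≤ G.edgeFinset.card)
    (ha : ∀ k, 3 ≤ k → 1 ≤ 2 * a k) :
    ∑ φ : V → V, (∏ z, walkProb G z (φ z)) *
      ∑ C ∈ (cycles φ).filter (fun C => C.card = 2), accepted a ((cycles φ).erase C) ≤
      2 * (Fintype.card V : ℝ≥0∞) ^ 2 * goodMass (walkProb G) a Finset.univ := by
  classical
  let s : Finset ((_ : V → V) × Finset V) :=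
    (Finset.univ.filter fun φ : V → V => ∀ z, G.Adj z (φ z)).sigma
      fun φ => (cycles φ).filter fun C => C.card = 2
  have hs : ∀ i ∈ s, (∀ z, G.Adj z (i.1 z)) ∧ i.2 ∈ cycles i.1 ∧ i.2.card = 2 := by
    intro i hi
    simpa [s] using hi
  have hex : ∀ i : (_ : V → V) × Finset V, ∃ j : (V → V) × V × V, i ∈ s →
      Surgery i.1 i.2 j.1 j.2.1 j.2.2 ∧ ∀ z, G.Adj z (j.1 z) := by
    intro i
    by_cases hi : i ∈ s
    · obtain ⟨h1, h2, h3⟩ := hs i hi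
      obtain ⟨ψ, x, v, h⟩ := exists_surgery hG hE h1 h2 h3
      exact ⟨(ψ, x, v), fun _ => h⟩
    · exact ⟨(i.1, hG.nonempty.some, hG.nonempty.some), fun h => absurd h hi⟩
  choose f hf using hex
  have hinj : Set.InjOn f s := by
    intro i hi j hj hij
    have h1 := (hf i hi).1
    rw [hij] at h1
    obtain ⟨h2, h3⟩ := h1.injective (hf j hj).1
    exact Sigma.ext h2 (heq_of_eq h3)
  let h : (V → V) × V × V → ℝ≥0∞ := fun j =>
    (∏ z, walkProb G z (j.1 z)) * (2 * accepted a (cycles j.1))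
  calc _ = ∑ i ∈ s, (∏ z, walkProb G z (i.1 z)) * accepted a ((cycles i.1).erase i.2) := by
        rw [Finset.sum_sigma, Finset.sum_filter]
        refine Finset.sum_congr rfl fun φ _ => ?_
        split_ifs with hφ
        · rw [Finset.mul_sum]
        · have : ∏ z, walkProb G z (φ z) = 0 := by
            by_contra h; exact hφ (adj_of_prod_walkProb_ne_zero h)
          rw [this, zero_mul]
    _ ≤ ∑ i ∈ s, h (f i) := by
        refine Finset.sum_le_sum fun i hi => ?_
        simp only [h]
        rw [prod_walkProb_of_adj (hs i hi).1, prod_walkProb_of_adj (hf i hi).2]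
        gcongr
        exact (hf i hi).1.accepted_le ha
    _ = ∑ j ∈ s.image f, h j := (Finset.sum_image hinj).symm
    _ ≤ ∑ j, h j := Finset.sum_le_sum_of_subset (Finset.subset_univ _)
    _ = _ := by
        rw [Fintype.sum_prod_type]
        simp only [h, Finset.sum_const, Finset.card_univ, Fintype.card_prod, nsmul_eq_mul]
        rw [goodMass, mapSum_univ, Finset.mul_sum]
        refine Finset.sum_congr rfl fun φ _ => ?_
        push_cast
        ring

/-- The mass of the maps with one rejected cycle, in terms of those with none. -/
theorem badMass_univ_le (hG : G.Connected) (hE : Fintype.card V ≤ G.edgeFinset.card)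
    (ha : ∀ k, 3 ≤ k → 1 ≤ 2 * a k) (hb : b 1 = 0) (hb1 : b 2 ≤ 1)
    (hba : ∀ k, 3 ≤ k → b k ≤ a k) :
    badMass (walkProb G) a b Finset.univ ≤
      5 * (Fintype.card V : ℝ≥0∞) ^ 2 * goodMass (walkProb G) a Finset.univ := by
  have h1 : badMass (walkProb G) a b Finset.univ ≤
      Fintype.card V * goodMass (walkProb G) a Finset.univ +
        2 * (2 * (Fintype.card V : ℝ≥0∞) ^ 2 * goodMass (walkProb G) a Finset.univ) := by
    refine (mapSum_mono fun φ _ => rejectedOne_cycles_le hb hb1 hba φ).trans ?_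
    rw [mapSum_add, mapSum_const_mul, mapSum_const_mul]
    refine add_le_add le_rfl (mul_le_mul_right ?_ _)
    rw [mapSum_univ]
    exact sum_two_cycles_le hG hE ha
  have hn : (Fintype.card V : ℝ≥0∞) ≤ (Fintype.card V : ℝ≥0∞) ^ 2 := by
    exact_mod_cast Nat.le_self_pow two_ne_zero _
  calc _ ≤ _ := h1
    _ ≤ (Fintype.card V : ℝ≥0∞) ^ 2 * goodMass (walkProb G) a Finset.univ +
        2 * (2 * (Fintype.card V : ℝ≥0∞) ^ 2 * goodMass (walkProb G) a Finset.univ) := by gcongr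
    _ = _ := by ring

theorem neighborFinset_nonempty (hG : G.Connected) (hE : Fintype.card V ≤ G.edgeFinset.card)
    (u : V) : (G.neighborFinset u).Nonempty := by
  have hpos : 0 < G.edgeFinset.card := lt_of_lt_of_le (Fintype.card_pos_iff.2 ⟨u⟩) hE
  obtain ⟨e, he⟩ := Finset.card_pos.1 hpos
  have : Nontrivial V := by
    induction e with
    | h x y => exact ⟨x, y, (show G.Adj x y by simpa using he).ne⟩
  rw [← Finset.card_pos, SimpleGraph.card_neighborFinset_eq_degree]
  exact hG.preconnected.degree_pos_of_nontrivial u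

theorem sum_walkProb (hN : ∀ u, (G.neighborFinset u).Nonempty) (u : V) :
    ∑ w, walkProb G u w = 1 := by
  have hd : G.degree u ≠ 0 := by
    rw [← SimpleGraph.card_neighborFinset_eq_degree]
    exact (Finset.card_pos.2 (hN u)).ne'
  simp only [walkProb]
  rw [← Finset.sum_filter, Finset.sum_const, ← SimpleGraph.neighborFinset_eq_filter,
    SimpleGraph.card_neighborFinset_eq_degree, nsmul_eq_mul]
  exact ENNReal.mul_inv_cancel (by exact_mod_cast hd) (ENNReal.natCast_ne_top _)

/-- 2-cycles may never be accepted, so a map along edges without any is needed. One with the fewest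
2-cycles has none, since surgery removes one and creates none. -/
theorem goodMass_univ_ne_zero (hG : G.Connected) (hE : Fintype.card V ≤ G.edgeFinset.card)
    (ha1 : a 1 = 1) (ha : ∀ k, 3 ≤ k → 1 ≤ 2 * a k) :
    goodMass (walkProb G) a Finset.univ ≠ 0 := by
  classical
  have hN := neighborFinset_nonempty hG hE
  have hex : ∃ k, ∃ φ : V → V, (∀ z, G.Adj z (φ z)) ∧
      ((cycles φ).filter fun C => C.card = 2).card = k :=
    ⟨_, fun z => (hN z).choose, fun z => by
      simpa using (hN z).choose_spec, rfl⟩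
  obtain ⟨φ, hφ, hk⟩ := Nat.find_spec hex
  have hno : ∀ C ∈ cycles φ, C.card ≠ 2 := by
    intro C hC hC2
    obtain ⟨ψ, x, v, h, hψ⟩ := exists_surgery hG hE hφ hC hC2
    refine Nat.find_min hex (m := ((cycles ψ).filter fun C => C.card = 2).card) ?_ ⟨ψ, hψ, rfl⟩
    rw [← hk]
    refine Finset.card_lt_card ⟨fun D hD => ?_, fun hsub => ?_⟩
    · rw [Finset.mem_filter] at hD ⊢
      rcases h.mem_or D hD.1 with h1 | h1
      · exact ⟨Finset.mem_of_mem_erase h1, hD.2⟩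
      · omega
    · have h1 := Finset.mem_filter.1 (hsub (Finset.mem_filter.2 ⟨hC, hC2⟩))
      rcases h.mem_or C h1.1 with h2 | h2
      · exact Finset.notMem_erase _ _ h2
      · omega
  rw [goodMass, mapSum_univ]
  intro h0
  have h1 := (Finset.sum_eq_zero_iff.1 h0) φ (Finset.mem_univ φ)
  rw [prod_walkProb_of_adj hφ, mul_eq_zero, Finset.prod_eq_zero_iff, accepted,
    Finset.prod_eq_zero_iff] at h1
  rcases h1 with ⟨z, -, hz⟩ | ⟨C, hC, hC0⟩
  · simp at hz
  · have hpos := (mem_cycles.1 hC).nonempty.card_pos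
    by_cases h3 : C.card = 1
    · simp [h3, ha1] at hC0
    · have := ha C.card (by have := hno C hC; omega)
      rw [hC0] at this
      simp at this

end Bounds

/-! ### Worst-case cost over all choices of start vertices -/

section Value

variable {V : Type*} [Fintype V] [DecidableEq V]

open Classical in
/-- The greatest expected number of operations among the next `T` ones, over all choices of start
vertices, if the sampler is in the configuration `c`. -/
noncomputable def cost (G : SimpleGraph V) [DecidableRel G.Adj] (γ₂ γ : unitInterval) :
    ℕ → Config V → ℝ≥0∞
  | 0, _ => 0
  | T + 1, c => if c.phase = .halted then 0 else
      1 + ⨆ (v : V) (_ : c.unfixed.Nonempty → v ∈ c.unfixed),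
        ∫⁻ c', cost G γ₂ γ T c' ∂step G γ₂ γ v c

variable {G : SimpleGraph V} [DecidableRel G.Adj] {γ₂ γ : unitInterval}

theorem cost_halted {T : ℕ} {c : Config V} (h : c.phase = .halted) : cost G γ₂ γ T c = 0 := by
  cases T <;> simp [cost, h]

theorem cost_succ_le {T : ℕ} {c : Config V} {B : ℝ≥0∞}
    (h : ∀ v, (c.unfixed.Nonempty → v ∈ c.unfixed) →
      ∫⁻ c', cost G γ₂ γ T c' ∂step G γ₂ γ v c ≤ B) : cost G γ₂ γ (T + 1) c ≤ 1 + B := by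
  rw [cost]
  split_ifs
  · exact zero_le
  · gcongr
    exact iSup₂_le h

/-- Enlarging the horizon first lets the bounds for single operations have the same `T` on both
sides. -/
theorem cost_mono (T : ℕ) (c : Config V) : cost G γ₂ γ T c ≤ cost G γ₂ γ (T + 1) c := by
  induction T generalizing c with
  | zero => exact zero_le
  | succ T ih =>
    rw [cost, cost]
    split_ifs
    · exact le_rfl
    · gcongr
      exact ih _

theorem one_add_lintegral_step_le {T : ℕ} {c : Config V} (hc : c.phase ≠ .halted) {v : V}
    (hv : c.unfixed.Nonempty → v ∈ c.unfixed) :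
    1 + ∫⁻ c', cost G γ₂ γ T c' ∂step G γ₂ γ v c ≤ cost G γ₂ γ (T + 1) c := by
  rw [cost, if_neg hc]
  gcongr
  exact le_iSup₂_of_le v hv le_rfl

theorem lintegral_step_halted {T : ℕ} {c : Config V} (hc : c.phase = .halted) (v : V) :
    ∫⁻ c', cost G γ₂ γ T c' ∂step G γ₂ γ v c = 0 := by
  obtain ⟨U, S, l, p⟩ := c
  obtain rfl : p = .halted := hc
  rw [step, lintegral_dirac, cost_halted rfl]

theorem cost_choose_empty_le (T : ℕ) (S : Finset (V × V)) (l : List V) :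
    cost G γ₂ γ T ⟨∅, S, l, .choose⟩ ≤ 1 := by
  refine (cost_mono T _).trans ((cost_succ_le (B := 0) fun v _ => ?_).trans (by simp))
  simp only [step, if_true, lintegral_dirac]
  rw [cost_halted rfl]

theorem cost_choose_le {T : ℕ} {U : Finset V} (hU : U.Nonempty) (S : Finset (V × V)) (l : List V)
    {B : ℝ≥0∞} (h : ∀ v ∈ U, 1 + cost G γ₂ γ T ⟨U, S, [v], .move⟩ ≤ B) :
    cost G γ₂ γ T ⟨U, S, l, .choose⟩ ≤ B := by
  obtain ⟨v₀, hv₀⟩ := id hU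
  rw [← add_tsub_cancel_of_le (le_self_add.trans (h v₀ hv₀) : 1 ≤ B)]
  refine (cost_mono T _).trans (cost_succ_le fun v hv => ?_)
  simp only [step, hU.ne_empty, if_false, lintegral_dirac]
  exact ENNReal.le_sub_of_add_le_left ENNReal.one_ne_top (h v (hv hU))

theorem lintegral_map_uniformOfFinset {s : Finset V} (hs : s.Nonempty) (g : V → Config V)
    (f : Config V → ℝ≥0∞) :
    ∫⁻ c, f c ∂((PMF.uniformOfFinset s hs).map g).toMeasure =
      ∑ w, (if w ∈ s then (s.card : ℝ≥0∞)⁻¹ else 0) * f (g w) := by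
  let _ : MeasurableSpace V := ⊤
  rw [← PMF.toMeasure_map (hf := measurable_from_top),
    lintegral_map (Measurable.of_discrete) measurable_from_top, lintegral_fintype]
  refine Finset.sum_congr rfl fun w _ => ?_
  rw [PMF.toMeasure_apply_singleton _ _ (MeasurableSet.of_discrete), mul_comm]
  by_cases hw : w ∈ s <;> simp [hw]

theorem cost_move_le (hN : ∀ u, (G.neighborFinset u).Nonempty) (T : ℕ) (U : Finset V)
    (S : Finset (V × V)) (u : V) (l : List V) :
    cost G γ₂ γ (T + 1) ⟨U, S, u :: l, .move⟩ ≤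
      1 + ∑ w, walkProb G u w * cost G γ₂ γ T (moveTo ⟨U, S, u :: l, .move⟩ w) := by
  refine cost_succ_le fun v _ => ?_
  simp only [step, hN u, dif_pos]
  rw [lintegral_map_uniformOfFinset]
  simp [walkProb]

theorem cost_erase_le (T : ℕ) (U : Finset V) (S : Finset (V × V)) {l : List V} {w : V}
    (hw : w ∈ l) : cost G γ₂ γ T ⟨U, S, l, .erase w⟩ ≤
      cycleLength l w + cost G γ₂ γ T ⟨U, S, l.drop (l.idxOf w), .move⟩ := by
  induction l with
  | nil => simp at hw
  | cons u l ih =>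
    refine (cost_mono T _).trans ?_
    by_cases h : u = w
    · subst h
      refine (cost_succ_le (B := cost G γ₂ γ T ⟨U, S, u :: l, .move⟩) fun v _ => ?_).trans ?_
      · simp only [step, if_true, lintegral_dirac]; exact le_rfl
      · simp [cycleLength]
    · refine (cost_succ_le (B := cost G γ₂ γ T ⟨U, S, l, .erase w⟩) fun v _ => ?_).trans ?_
      · simp only [step, h, if_false, lintegral_dirac]; exact le_rfl
      · have hw' : w ∈ l := by
          rcases List.mem_cons.1 hw with h' | h'
          · exact absurd h'.symm h
          · exact h'
        refine (add_le_add le_rfl (ih hw')).trans ?_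
        rw [cycleLength, cycleLength, List.idxOf_cons_ne _ h, List.drop_succ_cons, ← add_assoc]
        gcongr
        push_cast
        exact le_of_eq (by ring)

theorem cost_record_le (T : ℕ) (U : Finset V) (S : Finset (V × V)) (l : List V) (w : V)
    {B : ℝ≥0∞} (hB : ∀ S', cost G γ₂ γ T ⟨U \ l.toFinset, S', [], .choose⟩ ≤ B) :
    cost G γ₂ γ T ⟨U, S, l, .record w⟩ ≤ l.length + 1 + B := by
  induction l generalizing U S w with
  | nil =>
    refine (cost_mono T _).trans ((cost_succ_le (B := B) fun v _ => ?_).trans (by simp))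
    simp only [step, lintegral_dirac]
    simpa using hB S
  | cons u l ih =>
    have h : U \ (u :: l).toFinset = U.erase u \ l.toFinset := by
      ext z; simp only [List.toFinset_cons, Finset.mem_sdiff, Finset.mem_insert,
        Finset.mem_erase]; tauto
    rw [h] at hB
    refine (cost_mono T _).trans ((cost_succ_le fun v _ => ?_).trans
      ((add_le_add le_rfl (ih (U.erase u) (insert (u, w) S) u hB)).trans ?_))
    · simp only [step, lintegral_dirac]; exact le_rfl
    · rw [List.length_cons]
      push_cast
      exact le_of_eq (by ring)

/-- The probability with which the sampler accepts a cycle of length `k`. -/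
noncomputable def acceptProb (γ₂ γ : unitInterval) (k : ℕ) : ℝ≥0∞ :=
  if k = 1 then 1 else if k = 2 then ENNReal.ofReal γ₂ else ENNReal.ofReal γ

theorem acceptProb_le_one (γ₂ γ : unitInterval) (k : ℕ) : acceptProb γ₂ γ k ≤ 1 := by
  rw [acceptProb]
  split_ifs
  · exact le_rfl
  · exact ENNReal.ofReal_le_one.2 γ₂.2.2
  · exact ENNReal.ofReal_le_one.2 γ.2.2

theorem lintegral_bernoulliMeasure (c c' : Config V) (p : unitInterval) (f : Config V → ℝ≥0∞) :
    ∫⁻ x, f x ∂bernoulliMeasure c c' p =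
      ENNReal.ofReal p * f c + (1 - ENNReal.ofReal p) * f c' := by
  have h1 : ((unitInterval.toNNReal p : NNReal) : ℝ≥0∞) = ENNReal.ofReal p := by
    rw [← ENNReal.ofReal_coe_nnreal]; rfl
  have h2 : ((unitInterval.toNNReal (unitInterval.symm p) : NNReal) : ℝ≥0∞) =
      1 - ENNReal.ofReal p := by
    rw [← ENNReal.ofReal_coe_nnreal, ← ENNReal.ofReal_one, ← ENNReal.ofReal_sub _ p.2.1]; rfl
  rw [bernoulliMeasure_def, lintegral_add_measure, lintegral_smul_measure,
    lintegral_smul_measure, lintegral_dirac, lintegral_dirac, ENNReal.smul_def,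
    ENNReal.smul_def, h1, h2, smul_eq_mul, smul_eq_mul]

theorem cost_test_le (T : ℕ) (U : Finset V) (S : Finset (V × V)) (l : List V) (w : V)
    (h : cycleLength l w ≠ 1) : cost G γ₂ γ T ⟨U, S, l, .test w⟩ ≤
      1 + (acceptProb γ₂ γ (cycleLength l w) * cost G γ₂ γ T ⟨U, S, l, .record w⟩ +
        (1 - acceptProb γ₂ γ (cycleLength l w)) * cost G γ₂ γ T ⟨U, S, l, .erase w⟩) := by
  refine (cost_mono T _).trans (cost_succ_le fun v _ => ?_)
  simp only [step]
  rw [lintegral_bernoulliMeasure, acceptProb, if_neg h, apply_ite (fun p : unitInterval =>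
    ENNReal.ofReal (p : ℝ))]

theorem length_eq_drop_add {l : List V} {w : V} (hw : w ∈ l) :
    l.length + 1 = (l.drop (l.idxOf w)).length + cycleLength l w := by
  have := List.idxOf_lt_length_of_mem hw
  rw [List.length_drop, cycleLength]
  omega

/-- The number of operations of the sampler from the outer loop on. -/
theorem cost_choose_le_potential (hN : ∀ u, (G.neighborFinset u).Nonempty) (T : ℕ) (U : Finset V)
    (S : Finset (V × V)) (l : List V) :
    cost G γ₂ γ T ⟨U, S, l, .choose⟩ ≤ U.card + potential (walkProb G) (acceptProb γ₂ γ)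
      (fun k => 1 - acceptProb γ₂ γ k) U := by
  classical
  induction U using Finset.strongInduction generalizing T S l with
  | H U ih =>
  set a := acceptProb γ₂ γ with ha_def
  set b : ℕ → ℝ≥0∞ := fun k => 1 - a k with hb_def
  have hab : ∀ k, a k + b k = 1 := fun k => add_tsub_cancel_of_le (acceptProb_le_one γ₂ γ k)
  have ha : a 1 = 1 := by simp [ha_def, acceptProb]
  have hb : b 1 = 0 := by simp [hb_def, ha]
  have hone : 1 ≤ potential (walkProb G) a b U := by
    rw [potential]
    split_ifs
    · exact le_top
    · rw [add_assoc]; exact le_self_add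
  rcases U.eq_empty_or_nonempty with rfl | hU
  · exact (cost_choose_empty_le T S l).trans (hone.trans le_add_self)
  -- a walk with stack `m` has `|U| - |m|` steps to new vertices to its credit
  let X : ℕ → List V → ℝ≥0∞ := fun T m =>
    (⨆ S, cost G γ₂ γ T ⟨U, S, m, .move⟩) + m.length - U.card
  have hXle : ∀ T m S, cost G γ₂ γ T ⟨U, S, m, .move⟩ + m.length ≤ X T m + U.card := by
    intro T m S
    refine le_trans ?_ le_tsub_add
    gcongr
    exact le_iSup (fun S => cost G γ₂ γ T ⟨U, S, m, .move⟩) S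
  have hlen : ∀ {v m}, IsStack U v m → (m.length : ℝ≥0∞) + (U \ m.toFinset).card = U.card := by
    intro v m hm
    have hsub : m.toFinset ⊆ U := fun x hx => hm.2.1 x (List.mem_toFinset.1 hx)
    rw [← List.toFinset_card_of_nodup hm.1, ← Nat.cast_add, add_comm,
      Finset.card_sdiff_add_card_eq_card hsub]
  have hrec : ∀ {v m} T S w, IsStack U v m → cost G γ₂ γ T ⟨U, S, m, .record w⟩ ≤
      1 + U.card + potential (walkProb G) a b (U \ m.toFinset) := by
    intro v m T S w hm
    have hss : U \ m.toFinset ⊂ U := by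
      refine Finset.sdiff_ssubset (fun x hx => hm.2.1 x (List.mem_toFinset.1 hx)) ?_
      exact ⟨v, List.mem_toFinset.2 (List.mem_of_getLast? hm.2.2)⟩
    refine (cost_record_le T U S m w fun S' => ih _ hss T S' []).trans (le_of_eq ?_)
    rw [← hlen hm]
    ring
  have hwalk : ∀ v ∈ U, ∀ T, X T [v] ≤ potential (walkProb G) a b U := by
    intro v hv T
    refine walk_cost_le_potential (sum_walkProb hN) ha hb hab hv X ?_ ?_ T
    · intro m hm
      simp only [X, cost, iSup_const, zero_add]
      rw [← hlen hm]
      exact tsub_eq_zero_of_le le_self_add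
    · intro T m hm
      obtain ⟨u, m', rfl⟩ : ∃ u m', m = u :: m' := by
        rcases m with _ | ⟨u, m'⟩
        · exact absurd hm not_isStack_nil
        · exact ⟨u, m', rfl⟩
      rw [show X (T + 1) (u :: m') = (⨆ S, cost G γ₂ γ (T + 1) ⟨U, S, u :: m', .move⟩) +
        (u :: m').length - U.card from rfl, tsub_le_iff_right, ENNReal.iSup_add]
      refine iSup_le fun S => ?_
      refine (add_le_add (cost_move_le hN T U S u m') le_rfl).trans ?_
      set m := u :: m' with hm_def
      have hm1 : (1 : ℝ≥0∞) ≤ m.length := by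
        rw [hm_def, List.length_cons]; push_cast; exact le_add_self
      have hconst : ∀ c : ℝ≥0∞, c = ∑ w, walkProb G u w * c := fun c => by
        rw [← Finset.sum_mul, sum_walkProb hN, one_mul]
      rw [add_right_comm, hconst (1 + m.length), hconst U.card, stepMean,
        ← Finset.sum_add_distrib, ← Finset.sum_add_distrib]
      refine Finset.sum_le_sum fun w _ => ?_
      rw [← mul_add, ← mul_add]
      by_cases hadj : G.Adj u w
      swap
      · simp [walkProb, hadj]
      refine mul_le_mul_right ?_ _
      rw [← hm_def]
      by_cases hwU : w ∈ U
      · by_cases hwm : w ∈ m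
        -- A graph has no loops, so the convention for cycles of length 1 never affects the sampler.
        · have hk : cycleLength m w ≠ 1 := by
            rw [cycleLength, hm_def, List.idxOf_cons_ne _ hadj.ne]; omega
          have hk1 : (1 : ℝ≥0∞) ≤ cycleLength m w := by
            exact_mod_cast Nat.le_add_left 1 _
          have hdrop := length_eq_drop_add hwm
          have hdrop : (m.length : ℝ≥0∞) + 1 =
              (m.drop (m.idxOf w)).length + cycleLength m w := by exact_mod_cast hdrop
          have hmove : moveTo ⟨U, S, m, .move⟩ w = ⟨U, S, m, .test w⟩ := by
            simp [moveTo, hwU, hwm]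
          simp only [hmove, hwm, true_or, if_true, walkKernel, stopProb, rejectedLength]
          have h1 := cost_test_le (G := G) (γ₂ := γ₂) (γ := γ) T U S m w hk
          have h2 := hrec T S w hm
          have h3 := cost_erase_le (G := G) (γ₂ := γ₂) (γ := γ) T U S hwm
          have h4 := hXle T (m.drop (m.idxOf w)) S
          set k := cycleLength m w
          set Φ := potential (walkProb G) a b (U \ m.toFinset)
          set q := cost G γ₂ γ T ⟨U, S, m.drop (m.idxOf w), .move⟩
          set d := m.drop (m.idxOf w)
          -- Acceptance pays for the step, the test, the recording and the used credit, at most `4 *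
          -- m.length` beyond the rest. Rejection pays for the step, the test, `k` operations of
          -- erasure and the credit of the `k - 1` vertices lost, at most `3 * k`.
          calc 1 + (m.length : ℝ≥0∞) + cost G γ₂ γ T ⟨U, S, m, .test w⟩
              ≤ 1 + m.length + (1 + (a k * (1 + U.card + Φ) + b k * (k + q))) := by
                refine add_le_add le_rfl (h1.trans ?_)
                gcongr
            _ = (a k + b k) * (1 + m.length + 1) + (a k * (1 + U.card + Φ) + b k * (k + q)) := by
                rw [hab]; ring
            _ = a k * (2 + 1 + m.length + U.card + Φ) + b k * (1 + (m.length + 1) + k + q) := by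
                ring
            _ = a k * (2 + 1 + m.length + U.card + Φ) + b k * (1 + 2 * k + (q + d.length)) := by
                rw [hdrop]; ring
            _ ≤ a k * (2 * m.length + m.length + m.length + U.card + Φ) +
                b k * (k + 2 * k + (X T d + U.card)) := by
                gcongr
                exact le_mul_of_one_le_right' hm1
            _ ≤ a k * (5 * m.length + U.card + Φ) + b k * (4 * k + (X T d + U.card)) := by
                gcongr
                · calc (2 * m.length + m.length + m.length : ℝ≥0∞) = 4 * m.length := by ring
                    _ ≤ 5 * m.length := by gcongr; norm_num
                · calc (k + 2 * k : ℝ≥0∞) = 3 * k := by ring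
                    _ ≤ 4 * k := by gcongr; norm_num
            _ = a k * (5 * m.length + Φ) + 4 * (k * b k) + b k * X T d +
                (a k + b k) * U.card := by ring
            _ = _ := by rw [hab, one_mul]
        · have hmove : moveTo ⟨U, S, m, .move⟩ w = ⟨U, S, w :: m, .move⟩ := by
            simp [moveTo, hwU, hwm]
          simp only [hmove, hwm, hwU, not_true, or_self, if_false, if_true, walkKernel, zero_add]
          refine le_trans (le_of_eq ?_) (hXle T (w :: m) S)
          rw [List.length_cons (a := w) (as := m)]
          push_cast
          ring
      · have hwm : w ∉ m := fun h => hwU (hm.2.1 w h)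
        have hmove : moveTo ⟨U, S, m, .move⟩ w = ⟨U, S, m, .record w⟩ := by
          simp [moveTo, hwU]
        simp only [hmove, hwm, hwU, not_false_iff, or_true, if_false, if_true, walkKernel,
          stopProb, rejectedLength, one_mul, mul_zero, add_zero]
        calc 1 + (m.length : ℝ≥0∞) + cost G γ₂ γ T ⟨U, S, m, .record w⟩
            ≤ 1 + m.length + (1 + U.card + potential (walkProb G) a b (U \ m.toFinset)) := by
              gcongr
              exact hrec T S w hm
          _ = 2 + m.length + U.card + potential (walkProb G) a b (U \ m.toFinset) := by ring
          _ ≤ 4 * m.length + m.length + U.card + potential (walkProb G) a b (U \ m.toFinset) := by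
              gcongr
              calc (2 : ℝ≥0∞) ≤ 4 * 1 := by norm_num
                _ ≤ 4 * m.length := by gcongr
          _ = _ := by ring
  refine cost_choose_le hU S l fun v hv => ?_
  have h := (hXle T [v] S).trans (add_le_add (hwalk v hv T) le_rfl)
  rw [List.length_singleton, Nat.cast_one] at h
  rwa [add_comm, add_comm (U.card : ℝ≥0∞)]

end Value

/-! ### From the worst-case cost to the law of the execution -/

section Execution

variable {V : Type*} [Fintype V] [DecidableEq V] {G : SimpleGraph V} [DecidableRel G.Adj]
  {γ₂ γ : unitInterval} {r : Rule V}

theorem lintegral_execution_succ (s : ℕ) (f : Config V → ℝ≥0∞) :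
    ∫⁻ ω, f (ω (s + 1)) ∂execution G γ₂ γ r =
      ∫⁻ ω, ∫⁻ c, f c ∂step G γ₂ γ (r.pick s (Preorder.frestrictLe s ω)) (ω s)
        ∂execution G γ₂ γ r := by
  have h := Kernel.partialTraj_compProd_eq_map_traj (X := fun _ => Config V)
    (κ := transition G γ₂ γ r) (Nat.zero_le s)
    (x₀ := fun _ => initial V)
  have hf : Measurable fun q : History V s × Config V => f q.2 :=
    Measurable.of_discrete.comp measurable_snd
  have h1 : ∫⁻ ω, f (ω (s + 1)) ∂execution G γ₂ γ r =
      ∫⁻ q, f q.2 ∂(Kernel.partialTraj (X := fun _ => Config V) (transition G γ₂ γ r) 0 s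
        (fun _ => initial V)) ⊗ₘ transition G γ₂ γ r s := by
    rw [h, lintegral_map hf (by fun_prop)]
    rfl
  rw [h1, Measure.lintegral_compProd hf, ← Kernel.traj_map_frestrictLe_apply, lintegral_map]
  · rfl
  · exact hf.lintegral_kernel_prod_right'
  · fun_prop

theorem lintegral_execution_zero (f : Config V → ℝ≥0∞) :
    ∫⁻ ω, f (ω 0) ∂execution G γ₂ γ r = f (initial V) := by
  have h := Kernel.traj_map_frestrictLe_apply (X := fun _ => Config V)
    (κ := transition G γ₂ γ r) 0 0 (fun _ => initial V)
  rw [Kernel.partialTraj_self, Kernel.id_apply] at h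
  have hf : Measurable fun q : History V 0 => f (q ⟨0, by simp⟩) :=
    Measurable.of_discrete.comp (measurable_pi_apply _)
  have h1 : ∫⁻ ω, f (ω 0) ∂execution G γ₂ γ r =
      ∫⁻ q : History V 0, f (q ⟨0, by simp⟩) ∂(execution G γ₂ γ r).map
        (Preorder.frestrictLe 0) := by
    rw [lintegral_map hf (by fun_prop)]
    rfl
  rw [h1, execution, h, lintegral_dirac' _ hf]

open Classical in
/-- The indicator of the configurations in which the sampler has not halted. -/
noncomputable def running (c : Config V) : ℝ≥0∞ := if c.phase = .halted then 0 else 1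

theorem measurable_running (t : ℕ) : Measurable fun ω : ℕ → Config V => running (ω t) :=
  (Measurable.of_discrete (f := running (V := V))).comp (measurable_pi_apply t)

theorem running_add_lintegral_step_le (T : ℕ) {c : Config V} {v : V}
    (hv : c.unfixed.Nonempty → v ∈ c.unfixed) :
    running c + ∫⁻ c', cost G γ₂ γ T c' ∂step G γ₂ γ v c ≤ cost G γ₂ γ (T + 1) c := by
  rw [running]
  split_ifs with h
  · rw [lintegral_step_halted h, add_zero]; exact zero_le
  · exact one_add_lintegral_step_le h hv

/-- Since `cost` takes the supremum over start vertices at every step, the conditional expectation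
given the whole history is bounded through the current configuration alone, and the rule drops out.
-/
theorem sum_lintegral_running_le (T s : ℕ) :
    ∑ t ∈ Finset.range T, ∫⁻ ω, running (ω (s + t)) ∂execution G γ₂ γ r ≤
      ∫⁻ ω, cost G γ₂ γ T (ω s) ∂execution G γ₂ γ r := by
  induction T generalizing s with
  | zero => simp
  | succ T ih =>
    rw [Finset.sum_range_succ']
    have h1 := ih (s + 1)
    rw [lintegral_execution_succ] at h1
    have h2 : ∀ t, ∫⁻ ω, running (ω (s + (t + 1))) ∂execution G γ₂ γ r =
        ∫⁻ ω, running (ω (s + 1 + t)) ∂execution G γ₂ γ r := fun t => by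
      rw [show s + (t + 1) = s + 1 + t by ring]
    rw [Finset.sum_congr rfl fun t _ => h2 t, add_zero]
    refine (add_le_add h1 le_rfl).trans ?_
    rw [← lintegral_add_right _ (measurable_running s)]
    refine lintegral_mono fun ω => ?_
    rw [add_comm]
    exact running_add_lintegral_step_le T (r.pick_mem s (Preorder.frestrictLe s ω))

theorem runTime_le (ω : ℕ → Config V) :
    runTime ω ≤ Fintype.card V + ∑' t, running (ω t) := by
  classical
  rw [runTime]
  gcongr
  by_cases h : ∃ t, (ω t).phase = .halted
  · refine (iInf₂_le (Nat.find h) (Nat.find_spec h)).trans ?_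
    refine le_trans (le_of_eq ?_) (ENNReal.sum_le_tsum (Finset.range (Nat.find h)))
    have h1 : ∀ t ∈ Finset.range (Nat.find h), running (ω t) = 1 := fun t ht =>
      if_neg (Nat.find_min h (Finset.mem_range.1 ht))
    rw [Finset.sum_congr rfl h1]
    simp
  · push Not at h
    have : ∀ t, running (ω t) = 1 := fun t => if_neg (h t)
    simp only [this, ENNReal.tsum_const_eq_top_of_ne_zero one_ne_zero, le_top]

theorem expectedRunTime_le {B : ℝ≥0∞} (hB : ∀ T, cost G γ₂ γ T (initial V) ≤ B) :
    expectedRunTime G γ₂ γ r ≤ Fintype.card V + B := by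
  have : IsProbabilityMeasure (execution G γ₂ γ r) := by
    unfold execution; infer_instance
  refine (lintegral_mono runTime_le).trans ?_
  rw [lintegral_add_left measurable_const, lintegral_const, measure_univ, mul_one,
    lintegral_tsum fun t => (measurable_running t).aemeasurable]
  gcongr
  refine ENNReal.tsum_le_of_sum_range_le fun T => ?_
  have h := sum_lintegral_running_le (G := G) (γ₂ := γ₂) (γ := γ) (r := r) T 0
  simp only [zero_add] at h
  rw [lintegral_execution_zero] at h
  exact h.trans (hB T)

end Execution

theorem expectedRunTime_le_sq {V : Type*} [Fintype V] [DecidableEq V] {G : SimpleGraph V}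
    [DecidableRel G.Adj] (γ₂ γ : unitInterval) (r : Rule V) (hG : G.Connected)
    (hE : Fintype.card V ≤ G.edgeFinset.card) (hγ : (1 / 2 : ℝ) ≤ (γ : ℝ)) :
    expectedRunTime G γ₂ γ r ≤ 28 * (Fintype.card V : ℝ≥0∞) ^ 2 := by
  have hN := neighborFinset_nonempty hG hE
  have ha1 : acceptProb γ₂ γ 1 = 1 := by simp [acceptProb]
  have hhalf : (2 : ℝ≥0∞)⁻¹ ≤ ENNReal.ofReal γ := by
    rw [← ENNReal.ofReal_ofNat, ← ENNReal.ofReal_inv_of_pos two_pos]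
    exact ENNReal.ofReal_le_ofReal (by rw [← one_div]; exact hγ)
  have hak : ∀ k, 3 ≤ k → acceptProb γ₂ γ k = ENNReal.ofReal γ := fun k hk => by
    rw [acceptProb, if_neg (by omega), if_neg (by omega)]
  have ha : ∀ k, 3 ≤ k → 1 ≤ 2 * acceptProb γ₂ γ k := fun k hk => by
    rw [hak k hk, ← ENNReal.mul_inv_cancel two_ne_zero ENNReal.ofNat_ne_top]
    gcongr
  have hba : ∀ k, 3 ≤ k → 1 - acceptProb γ₂ γ k ≤ acceptProb γ₂ γ k := fun k hk => by
    rw [tsub_le_iff_right, ← two_mul]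
    exact ha k hk
  have hZ := goodMass_univ_ne_zero hG hE ha1 ha
  have hZ' := goodMass_ne_top (sum_walkProb hN) (acceptProb_le_one γ₂ γ) (Finset.univ : Finset V)
  have hB := badMass_univ_le (b := fun k => 1 - acceptProb γ₂ γ k) hG hE ha (by simp [ha1])
    tsub_le_self hba
  have hratio := (ENNReal.div_le_iff hZ hZ').2 hB
  have hcost := fun T => cost_choose_le_potential (γ₂ := γ₂) (γ := γ) hN T Finset.univ ∅ []
  rw [potential, if_neg hZ, Finset.card_univ] at hcost
  have hn : (Fintype.card V : ℝ≥0∞) ≤ (Fintype.card V : ℝ≥0∞) ^ 2 := by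
    exact_mod_cast Nat.le_self_pow two_ne_zero _
  have h1 : (1 : ℝ≥0∞) ≤ (Fintype.card V : ℝ≥0∞) ^ 2 := by
    have := Fintype.card_pos_iff.2 hG.nonempty
    exact_mod_cast Nat.one_le_pow _ _ this
  refine (expectedRunTime_le hcost).trans ?_
  -- The terms are initialisation, step credit, the constant 1, `5 * n` and `4 * B / Z`; hence 28 =
  -- 1 + 1 + 1 + 5 + 20.
  calc _ ≤ (Fintype.card V : ℝ≥0∞) ^ 2 + ((Fintype.card V : ℝ≥0∞) ^ 2 +
        ((Fintype.card V : ℝ≥0∞) ^ 2 + 5 * (Fintype.card V : ℝ≥0∞) ^ 2 +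
          4 * (5 * (Fintype.card V : ℝ≥0∞) ^ 2))) := by gcongr
    _ = _ := by ring

end GibbsSampler

/-- There is a universal constant `C` such that, on every connected graph with `n` vertices and at
least `n` edges, for all `γ₂ ∈ [0, 1]` and `γ ∈ [1/2, 1]` and however the start vertices are chosen,
the expected run-time of the sampler is at most `C n²`. -/
theorem corollary1 :
    ∃ C : NNReal, ∀ (V : Type*) [Fintype V] [DecidableEq V]
      (G : SimpleGraph V) [DecidableRel G.Adj] (γ₂ γ : unitInterval) (r : GibbsSampler.Rule V),
      G.Connected → Fintype.card V ≤ G.edgeFinset.card → (1 / 2 : ℝ) ≤ (γ : ℝ) →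
      GibbsSampler.expectedRunTime G γ₂ γ r ≤ (C : ENNReal) * (Fintype.card V : ENNReal) ^ 2 := by
  refine ⟨28, fun V _ _ G _ γ₂ γ r hG hE hγ => ?_⟩
  exact_mod_cast GibbsSampler.expectedRunTime_le_sq γ₂ γ r hG hE hγ
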